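/- Let $n\ge 2$, let $Q\subset\mathbb R^2$ be compact and convex, and let $\varphi\ge 0$ be an integrable density on $Q$. Let $f(a,b)$, $a,b\ge0$, be a symmetric cost function ($f(a,b)=f(b,a)$) that is locally Lipschitz on $[0,\infty)^2$ and continuously differentiable on $(0,\infty)^2$, with $\partial f/\partial a\ge 0$ and $\partial f/\partial b\ge 0$ there (for example, any symmetric $f$ that is continuously differentiable on $[0,\infty)^2$ with nonnegative partial derivatives). For $p=(p_1,\dots,p_n)\in(\mathbb R^2)^n$ put $$\mathcal H(p)=\int_Q \min_{i<j} f(\|q-p_i\|,\|q-p_j\|)\,\varphi(q)\,dq ,$$ and for a pair $T=\{i,j\}$, $i\ne j$, let $V_{T}=\{q\in Q:\ \|q-p_v\|\le\|q-p_w\|\ \text{for all } v\in T,\ w\notin T\}$ be its order-2 Voronoi cell. (1) At every configuration of pairwise distinct positions $\mathcal H$ is differentiable, with $$\frac{\partial\mathcal H}{\partial p_i}=\sum_{j\ne i}\int_{V_{\{i,j\}}}\frac{\partial}{\partial p_i}f(\|q-p_i\|,\|q-p_j\|)\,\varphi(q)\,dq .$$ If $p(t)$, $t\ge0$, is a solution,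 with pairwise distinct positions at all times $t\ge 0$, of the gradient system $\dot p_i=-\partial\mathcal H/\partial p_i$ $(i=1,\dots,n)$ given by this formula, then the distance from $p(t)$ to the set of critical points of $\mathcal H$ (points of $(\mathbb R^2)^n$, not necessarily with distinct positions, where $\mathcal H$ is differentiable with zero derivative) tends to $0$ as $t\to\infty$; this set is nonempty whenever such a solution exists. (2) Let $f(a,b)=\frac12(a^2+b^2)$ and suppose that every disc centred at a point of $Q$ meets $Q$ in a set of positive $\varphi$-mass. For $V\subset Q$ put $M_V=\int_V\varphi$, $C_V=M_V^{-1}\int_V q\varphi(q)\,dq$ (terms with $M_V=0$ are dropped below), and for $W_i=\bigcup_{T\ni i}V_T$ put $M_{W_i}=\sum_{T\ni i}M_{V_T}$ and $C_{W_i}=M_{W_i}^{-1}\sum_{T\ni i}M_{V_T}C_{V_T}$, sums over the pairs $T$ containing $i$. Let $K>0$ and let $p(t)$, $t\ge0$, be a solution of $\dot p_i=K(C_{W_i}-p_i)$ $(i=1,\dots,n)$ with pairwise distinct positions at all times $t\ge 0$ and with $p_i(0)\in Q$ for all $i$. Then $p_i(t)-C_{W_i}(p(t))\to0$ as $t\to\infty$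 for every $i$, and the distance from $p(t)$ to the set of order-2 centroidal Voronoi configurations that are critical points of $\mathcal H$ tends to $0$ (and this set is nonempty). Here $x\in(\mathbb R^2)^n$ is an order-2 centroidal Voronoi configuration if all $x_i\in Q$, different order-2 cells overlap only in null sets, and for every $i$ one has $M_{W_i}>0$ and $x_i=C_{W_i}$. -/

import Mathlib

open Set Filter Topology MeasureTheory

noncomputable section

/-- The plane with its Euclidean norm. -/
abbrev Plane : Type := EuclideanSpace ℝ (Fin 2)

/-- Positions of `n` agents in the plane. -/
abbrev Config (n : ℕ) : Type := Fin n → Plane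

/-- Admissible sensing costs `f(a, b)`, `a, b ≥ 0` being the distances from a point to two agents:
regular, nondecreasing in each distance, and symmetric. -/
structure IsSensingCost (f : ℝ → ℝ → ℝ) : Prop where
  locallyLipschitz : LocallyLipschitzOn (Ici (0 : ℝ) ×ˢ Ici (0 : ℝ)) (fun z : ℝ × ℝ => f z.1 z.2)
  contDiff : ContDiffOn ℝ 1 (fun z : ℝ × ℝ => f z.1 z.2) (Ioi (0 : ℝ) ×ˢ Ioi (0 : ℝ))
  deriv_fst_nonneg : ∀ a b : ℝ, 0 < a → 0 < b → 0 ≤ deriv (fun s => f s b) a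
  deriv_snd_nonneg : ∀ a b : ℝ, 0 < a → 0 < b → 0 ≤ deriv (fun s => f a s) b
  symm : ∀ a b : ℝ, 0 ≤ a → 0 ≤ b → f a b = f b a

/-- The cost `½ (a² + b²)`. -/
def quadCost (a b : ℝ) : ℝ := (1 / 2) * (a ^ 2 + b ^ 2)

/-- The order-2 performance function
`H(p) = ∫_Q min_{i < j} f(‖q - p_i‖, ‖q - p_j‖) φ(q) dq`. -/
def performance {n : ℕ} (Q : Set Plane) (φ : Plane → ℝ) (f : ℝ → ℝ → ℝ) (p : Config n) : ℝ :=
  ∫ q in Q, (⨅ c : {c : Fin n × Fin n // c.1 < c.2},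
    f (dist q (p c.1.1)) (dist q (p c.1.2))) * φ q

/-- The Voronoi cell in `Q` of a set `T` of agents: the points of `Q` that are not further from
any agent in `T` than from any agent not in `T`. -/
def voronoiCell {n : ℕ} (Q : Set Plane) (p : Config n) (T : Finset (Fin n)) : Set Plane :=
  {q | q ∈ Q ∧ ∀ v ∈ T, ∀ w ∉ T, dist q (p v) ≤ dist q (p w)}

/-- The sum over the pairs `T = {i, j}` containing `i` of
`∫_{V_T} ∂/∂p_i f(‖q - p_i‖, ‖q - p_j‖) φ(q) dq`. -/
def cellGradient {n : ℕ} (Q : Set Plane) (φ : Plane → ℝ) (f : ℝ → ℝ → ℝ) (p : Config n) :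
    Config n := fun i =>
  ∑ j ∈ Finset.univ.erase i, ∫ q in voronoiCell Q p {i, j},
    φ q • gradient (fun x : Plane => f (dist q x) (dist q (p j))) (p i)

/-- The mass `∫_V φ`. -/
def mass (φ : Plane → ℝ) (V : Set Plane) : ℝ := ∫ q in V, φ q

/-- The centroid `(∫_V q φ(q) dq) / (∫_V φ(q) dq)`. -/
def massCentroid (φ : Plane → ℝ) (V : Set Plane) : Plane := (mass φ V)⁻¹ • ∫ q in V, φ q • q

/-- The pairs of agents that contain agent `i`. -/
def pairsWith {n : ℕ} (i : Fin n) : Finset (Finset (Fin n)) :=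
  (Finset.powersetCard 2 Finset.univ).filter (fun T => i ∈ T)

/-- The mass of `W_i`, the union of the order-2 cells of the pairs containing `i`. -/
def massW {n : ℕ} (Q : Set Plane) (φ : Plane → ℝ) (p : Config n) (i : Fin n) : ℝ :=
  ∑ T ∈ pairsWith i, mass φ (voronoiCell Q p T)

/-- The centroid of `W_i`: the average of the centroids of its cells, weighted by mass. -/
def centroidW {n : ℕ} (Q : Set Plane) (φ : Plane → ℝ) (p : Config n) (i : Fin n) : Plane :=
  (massW Q φ p i)⁻¹ •
    ∑ T ∈ pairsWith i, mass φ (voronoiCell Q p T) • massCentroid φ (voronoiCell Q p T)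

/-- `p` solves `ṗ_i = F(p)_i` for all times `t ≥ 0`, with agents at pairwise distinct positions. -/
def IsClosedLoopSolution {n : ℕ} (F : Config n → Config n) (p : ℝ → Config n) : Prop :=
  ∀ t : ℝ, 0 ≤ t → Function.Injective (p t) ∧
    ∀ i, HasDerivWithinAt (fun s => p s i) (F (p t) i) (Ici 0) t

/-- The critical points of `H`: it is differentiable there, with zero derivative. Positions need
not be distinct. -/
def criticalPoints {n : ℕ} (H : Config n → ℝ) : Set (Config n) :=
  {x | HasFDerivAt H (0 : Config n →L[ℝ] ℝ) x}

/-- The distance from `p t` to the set `S` tends to `0` as `t → ∞`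
(as an extended distance, so this fails if `S` is empty). -/
def ConvergesToSet {n : ℕ} (p : ℝ → Config n) (S : Set (Config n)) : Prop :=
  Tendsto (fun t => Metric.infEDist (p t) S) atTop (𝓝 0)

/-- Order-2 centroidal Voronoi configurations: the agents lie in `Q`, different order-2 cells
overlap only in null sets, and each agent is at the centroid of its `W_i`, which has
positive mass. -/
def IsCentroidalConfig {n : ℕ} (Q : Set Plane) (φ : Plane → ℝ) (x : Config n) : Prop :=
  (∀ i, x i ∈ Q) ∧
  (∀ T T' : Finset (Fin n), T.card = 2 → T'.card = 2 → T ≠ T' →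
    volume (voronoiCell Q x T ∩ voronoiCell Q x T') = 0) ∧
  (∀ i, 0 < massW Q φ x i ∧ x i = centroidW Q φ x i)

end

/-! The agents are distinct at every time but may collide in the limit, where a minimum of costs
need not be differentiable. That is the whole difficulty.

At distinct positions almost every `q` has a unique nearest pair, so the minimum is differentiable
there with bounded gradient, and differentiation under the integral gives the formula. Along either
flow `H` decreases at a rate at least `κ‖∇H‖²` on a bounded trajectory, so each cluster point `x` is
a limit of injective configurations `p k` with `∇H(p k) → 0`
(`exists_seq_cellGradient_tendsto_zero`).

Such an `x` is critical (`mem_criticalPoints_of_tendsto`). Test `∇H(p k)` against the direction that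
moves apart two agents colliding at `x`. To first order this cannot increase the minimum, so the
integrand is asymptotically nonpositive at almost every point, while its integral tends to zero.
Hence it tends to zero almost everywhere along a subsequence, which forces `φ ∂f = 0` wherever a
nearest agent could be exchanged with a coincident one (`ae_isExchangeNull_of_tendsto`). After
multiplication by `φ` all nearest pairs then give the same gradient, and `H` is differentiable at
`x` with derivative `lim ∇H(p k) = 0` (`hasFDerivAt_performance_of_tendsto`).

For the quadratic cost `∂f/∂a = a`, so `φ` vanishes almost everywhere on the cell of an exchangeable
pair; by the disc condition and convexity that cell is null (`hasNullExchangeableCells`). Masses and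
moments are then continuous at `x`, and the limit of `∇H = M (p - C)` shows that `x` is centroidal.
-/

/-! ### Distances and sensing costs -/

/-- The partial derivative of a cost in its first argument. -/
noncomputable def pd (f : ℝ → ℝ → ℝ) (a b : ℝ) : ℝ := deriv (fun s => f s b) a

/-- The unit vector pointing from `q` to `y`. -/
noncomputable def unitTo (q y : Plane) : Plane := (dist q y)⁻¹ • (y - q)

lemma norm_unitTo_le (q y : Plane) : ‖unitTo q y‖ ≤ 1 := by
  rw [unitTo, norm_smul, norm_inv, Real.norm_of_nonneg dist_nonneg, dist_comm, dist_eq_norm]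
  exact inv_mul_le_one

lemma continuousAt_unitTo {q y : Plane} (h : q ≠ y) :
    ContinuousAt (fun z : Plane × Plane => unitTo z.1 z.2) (q, y) := by
  unfold unitTo
  have h1 : ContinuousAt (fun z : Plane × Plane => dist z.1 z.2) (q, y) := by fun_prop
  have h2 : ContinuousAt (fun z : Plane × Plane => z.2 - z.1) (q, y) := by fun_prop
  exact (h1.inv₀ (dist_ne_zero.2 h)).smul h2

lemma hasFDerivAt_dist_right {q y : Plane} (h : q ≠ y) :
    HasFDerivAt (fun x : Plane => dist q x) (innerSL ℝ (unitTo q y)) y := by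
  have h1 : HasFDerivAt (fun x : Plane => x - q) (ContinuousLinearMap.id ℝ Plane) y :=
    (hasFDerivAt_id y).sub_const q
  have h2 : HasFDerivAt (fun x : Plane => ‖x - q‖ ^ 2)
      (2 • (innerSL ℝ (y - q)).comp (ContinuousLinearMap.id ℝ Plane)) y := h1.norm_sq
  have h3 : ‖y - q‖ ≠ 0 := norm_ne_zero_iff.2 (sub_ne_zero.2 h.symm)
  have h4 := h2.sqrt (pow_ne_zero 2 h3)
  have e : (fun x : Plane => √(‖x - q‖ ^ 2)) = fun x => dist q x := by
    funext x
    rw [Real.sqrt_sq (norm_nonneg _), dist_comm, dist_eq_norm]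
  rw [e] at h4
  refine h4.congr_fderiv ?_
  rw [Real.sqrt_sq (norm_nonneg _)]
  ext w
  have h5 : dist q y = ‖y - q‖ := by rw [dist_comm, dist_eq_norm]
  simp only [unitTo, h5, innerSL_apply_apply, _root_.smul_apply,
    ContinuousLinearMap.comp_apply, ContinuousLinearMap.id_apply, inner_smul_left, smul_eq_mul,
    nsmul_eq_mul]
  simp
  field_simp

namespace IsSensingCost

variable {f : ℝ → ℝ → ℝ} (hf : IsSensingCost f)
include hf

lemma differentiableAt {a b : ℝ} (ha : 0 < a) (hb : 0 < b) :
    DifferentiableAt ℝ (fun z : ℝ × ℝ => f z.1 z.2) (a, b) :=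
  (hf.contDiff.contDiffAt ((isOpen_Ioi.prod isOpen_Ioi).mem_nhds (show (a, b) ∈ _ from ⟨ha, hb⟩))).differentiableAt
    (by norm_num)

lemma pd_eq_fderiv {a b : ℝ} (ha : 0 < a) (hb : 0 < b) :
    pd f a b = fderiv ℝ (fun z : ℝ × ℝ => f z.1 z.2) (a, b) (1, 0) := by
  have h1 := (hf.differentiableAt ha hb).hasFDerivAt
  have h2 : HasDerivAt (fun s : ℝ => (s, b)) ((1 : ℝ), (0 : ℝ)) a :=
    (hasDerivAt_id a).prodMk (hasDerivAt_const a b)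
  exact (h1.comp_hasDerivAt a h2).deriv

/-- Symmetry of the cost lets the single function `pd` express both partial derivatives. -/
lemma pd_swap {a b : ℝ} (ha : 0 < a) (hb : 0 < b) :
    pd f b a = fderiv ℝ (fun z : ℝ × ℝ => f z.1 z.2) (a, b) (0, 1) := by
  have h1 := (hf.differentiableAt ha hb).hasFDerivAt
  have h2 : HasDerivAt (fun s : ℝ => (a, s)) ((0 : ℝ), (1 : ℝ)) b :=
    (hasDerivAt_const b a).prodMk (hasDerivAt_id b)
  have h3 : HasDerivAt (fun s : ℝ => f a s) _ b := h1.comp_hasDerivAt b h2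
  rw [← h3.deriv, pd]
  apply Filter.EventuallyEq.deriv_eq
  filter_upwards [lt_mem_nhds hb] with s hs using hf.symm _ _ hs.le ha.le

lemma hasFDerivAt {a b : ℝ} (ha : 0 < a) (hb : 0 < b) :
    HasFDerivAt (fun z : ℝ × ℝ => f z.1 z.2)
      (pd f a b • ContinuousLinearMap.fst ℝ ℝ ℝ + pd f b a • ContinuousLinearMap.snd ℝ ℝ ℝ)
      (a, b) := by
  convert (hf.differentiableAt ha hb).hasFDerivAt using 1
  rw [hf.pd_eq_fderiv ha hb, hf.pd_swap ha hb]
  ext <;> simp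

lemma pd_nonneg {a b : ℝ} (ha : 0 < a) (hb : 0 < b) : 0 ≤ pd f a b :=
  hf.deriv_fst_nonneg a b ha hb

lemma continuousAt_pd {a b : ℝ} (ha : 0 < a) (hb : 0 < b) :
    ContinuousAt (fun z : ℝ × ℝ => pd f z.1 z.2) (a, b) := by
  have ho : IsOpen (Ioi (0 : ℝ) ×ˢ Ioi (0 : ℝ)) := isOpen_Ioi.prod isOpen_Ioi
  have h1 := (hf.contDiff.continuousOn_fderiv_of_isOpen ho le_rfl).continuousAt
    (ho.mem_nhds (show (a, b) ∈ _ from ⟨ha, hb⟩))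
  have h2 : ContinuousAt (fun z : ℝ × ℝ =>
      fderiv ℝ (fun z : ℝ × ℝ => f z.1 z.2) z ((1 : ℝ), (0 : ℝ))) (a, b) :=
    h1.clm_apply continuousAt_const
  refine h2.congr ?_
  filter_upwards [ho.mem_nhds (show (a, b) ∈ _ from ⟨ha, hb⟩)] with z hz
  exact (hf.pd_eq_fderiv hz.1 hz.2).symm

lemma mono_fst {a a' b : ℝ} (ha : 0 < a) (hb : 0 < b) (h : a ≤ a') : f a b ≤ f a' b := by
  have hd : ∀ s : ℝ, 0 < s → DifferentiableAt ℝ (fun s => f s b) s := fun s hs =>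
    DifferentiableAt.comp s (f := fun s : ℝ => (s, b)) (hf.differentiableAt hs hb) (by fun_prop)
  have : MonotoneOn (fun s => f s b) (Ioi 0) := by
    apply monotoneOn_of_deriv_nonneg (convex_Ioi 0)
    · intro s hs
      exact (hd s hs).continuousAt.continuousWithinAt
    · rw [interior_Ioi]
      intro s hs
      exact (hd s hs).differentiableWithinAt
    · rw [interior_Ioi]
      exact fun s hs => hf.deriv_fst_nonneg s b hs hb
  exact this ha (ha.trans_le h) h

lemma mono {a a' b b' : ℝ} (ha : 0 < a) (hb : 0 < b) (h : a ≤ a') (h' : b ≤ b') :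
    f a b ≤ f a' b' := by
  have ha' := ha.trans_le h
  calc f a b ≤ f a' b := hf.mono_fst ha hb h
    _ = f b a' := hf.symm _ _ ha'.le hb.le
    _ ≤ f b' a' := hf.mono_fst hb ha' h'
    _ = f a' b' := hf.symm _ _ (hb.trans_le h').le ha'.le

lemma continuousOn : ContinuousOn (fun z : ℝ × ℝ => f z.1 z.2) (Ici (0 : ℝ) ×ˢ Ici (0 : ℝ)) :=
  hf.locallyLipschitz.continuousOn

lemma exists_lipschitz (R : ℝ) : ∃ K : NNReal,
    LipschitzOnWith K (fun z : ℝ × ℝ => f z.1 z.2) (Icc 0 R ×ˢ Icc 0 R) := by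
  apply LocallyLipschitzOn.exists_lipschitzOnWith_of_compact (isCompact_Icc.prod isCompact_Icc)
  exact hf.locallyLipschitz.mono (prod_mono Icc_subset_Ici_self Icc_subset_Ici_self)

end IsSensingCost

/-- The cost need not be differentiable at the boundary of the quadrant, so compactness does not
bound `pd` near it; the Lipschitz constant does. -/
lemma abs_pd_le_of_lipschitzOnWith {f : ℝ → ℝ → ℝ} {R : ℝ} {K : NNReal}
    (hK : LipschitzOnWith K (fun z : ℝ × ℝ => f z.1 z.2) (Icc 0 R ×ˢ Icc 0 R))
    {a b : ℝ} (ha : 0 < a) (hb : 0 < b) (ha' : a < R) (hb' : b < R) : |pd f a b| ≤ K := by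
  have h1 : ‖deriv (fun s => f s b) a‖ ≤ K := by
    apply norm_deriv_le_of_lipschitzOn (Icc_mem_nhds ha ha')
    have : LipschitzOnWith 1 (fun s : ℝ => (s, b)) (Icc 0 R) :=
      (LipschitzWith.prodMk_right b).lipschitzOnWith
    have h := hK.comp this (fun s hs => ⟨hs, hb.le, hb'.le⟩)
    rwa [mul_one] at h
  exact h1

/-! ### Combinatorics of nearest pairs -/

/-- With respect to the distances `d`, no agent outside `{i, j}` is closer than `i` or `j`. -/
def IsNearestPair {n : ℕ} (d : Fin n → ℝ) (i j : Fin n) : Prop :=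
  i ≠ j ∧ ∀ w, w ≠ i → w ≠ j → d i ≤ d w ∧ d j ≤ d w

namespace IsNearestPair

variable {n : ℕ} {d : Fin n → ℝ} {i j a b k : Fin n}

lemma swap (h : IsNearestPair d i j) : IsNearestPair d j i :=
  ⟨h.1.symm, fun w hw hw' => (h.2 w hw' hw).symm⟩

lemma exists_isNearestPair (hn : 2 ≤ n) (d : Fin n → ℝ) : ∃ i j, IsNearestPair d i j := by
  have : Nonempty (Fin n) := ⟨⟨0, by omega⟩⟩
  obtain ⟨i, -, hi⟩ := Finset.exists_min_image Finset.univ d Finset.univ_nonempty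
  have hne : (Finset.univ.erase i).Nonempty := by
    rw [← Finset.card_pos, Finset.card_erase_of_mem (Finset.mem_univ _), Finset.card_univ,
      Fintype.card_fin]
    omega
  obtain ⟨j, hj, hj'⟩ := Finset.exists_min_image _ d hne
  exact ⟨i, j, (Finset.ne_of_mem_erase hj).symm, fun w hw _ => ⟨hi w (Finset.mem_univ _),
    hj' w (Finset.mem_erase.2 ⟨hw, Finset.mem_univ _⟩)⟩⟩

lemma exists_of_forall_le (hn : 2 ≤ n) {d : Fin n → ℝ} {i : Fin n} (hi : ∀ k, d i ≤ d k) :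
    ∃ j, IsNearestPair d i j := by
  have hne : (Finset.univ.erase i).Nonempty := by
    rw [← Finset.card_pos, Finset.card_erase_of_mem (Finset.mem_univ _), Finset.card_univ,
      Fintype.card_fin]
    omega
  obtain ⟨j, hj, hj'⟩ := Finset.exists_min_image _ d hne
  exact ⟨j, (Finset.ne_of_mem_erase hj).symm, fun w hw _ => ⟨hi w,
    hj' w (Finset.mem_erase.2 ⟨hw, Finset.mem_univ _⟩)⟩⟩

/-- A nearest pair minimises the sum of two distances. All nearest pairs thus share this sum, and
two of them with a common agent have equal remaining distances. -/
lemma sum_le (h : IsNearestPair d i j) (hab : a ≠ b) : d i + d j ≤ d a + d b := by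
  have ha := h.2 a
  have hb := h.2 b
  by_cases h1 : a = i <;> by_cases h2 : a = j <;> by_cases h3 : b = i <;> by_cases h4 : b = j <;>
    grind

lemma sum_eq (h : IsNearestPair d i j) (h' : IsNearestPair d a b) : d i + d j = d a + d b :=
  le_antisymm (h.sum_le h'.1) (h'.sum_le h.1)

/-- An agent belonging to one nearest pair but not to another must be tied with an agent outside its
own pair. -/
lemma exists_eq_of_not_mem (h : IsNearestPair d i j) (h' : IsNearestPair d a b)
    (hia : i ≠ a) (hib : i ≠ b) : ∃ c, c ≠ i ∧ c ≠ j ∧ d c = d i := by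
  have hs := h.sum_eq h'
  have ha := h.2 a
  have hb := h.2 b
  have hi := h'.2 i hia hib
  by_cases h1 : a = j
  · exact ⟨b, by grind, by grind [h'.1], by grind⟩
  · exact ⟨a, by grind, by grind, by grind⟩

/-- Moves a tie at the nearest pair `i, j` to the nearest pair `a, b`, at the same distance. In the
limit argument the pair that recurs along the sequence cannot be prescribed, so the tie has to be
found there. -/
lemma exists_separated (h : IsNearestPair d a b) (h' : IsNearestPair d i j)
    (hki : k ≠ i) (hkj : k ≠ j) (hk : d k = d i) :
    ∃ s t u, (s = a ∧ t = b ∨ s = b ∧ t = a) ∧ u ≠ s ∧ u ≠ t ∧ d u = d s ∧ d s = d i := by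
  have hs := h.sum_eq h'
  have ha := h'.2 a
  have hb := h'.2 b
  have hi := h.2 i
  have hj := h.2 j
  have hk' := h'.2 k hki hkj
  have hab := h.1
  have hij := h'.1
  by_cases h1 : i = a
  · by_cases h2 : k = b
    · exact ⟨b, a, j, by grind⟩
    · exact ⟨a, b, k, by grind⟩
  · by_cases h2 : i = b
    · by_cases h3 : k = a
      · exact ⟨a, b, j, by grind⟩
      · exact ⟨b, a, k, by grind⟩
    · by_cases h3 : a = j
      · exact ⟨b, a, i, by grind⟩
      · exact ⟨a, b, i, by grind⟩

end IsNearestPair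

lemma mem_voronoiCell_pair {n : ℕ} {Q : Set Plane} {p : Config n} {i j : Fin n} (hij : i ≠ j)
    {q : Plane} : q ∈ voronoiCell Q p {i, j} ↔
      q ∈ Q ∧ IsNearestPair (fun k => dist q (p k)) i j := by
  simp only [voronoiCell, IsNearestPair, Set.mem_ofPred_eq, Finset.mem_insert,
    Finset.mem_singleton]
  grind

/-! ### Pointwise derivative of the minimal cost -/

/-- The gradient of `p ↦ f(‖q - p_i‖, ‖q - p_j‖)`. -/
noncomputable def pairGrad {n : ℕ} (f : ℝ → ℝ → ℝ) (q : Plane) (p : Config n) (i j : Fin n) :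
    Config n :=
  Pi.single i (pd f (dist q (p i)) (dist q (p j)) • unitTo q (p i)) +
    Pi.single j (pd f (dist q (p j)) (dist q (p i)) • unitTo q (p j))

/-- The inner product of configurations, as a bilinear map. -/
noncomputable def pairing (n : ℕ) : Config n →L[ℝ] Config n →L[ℝ] ℝ :=
  LinearMap.toContinuousLinearMap
    { toFun := fun v => ∑ k, (innerSL ℝ (v k)).comp (ContinuousLinearMap.proj k)
      map_add' := by
        intro v w
        rw [← Finset.sum_add_distrib]
        refine Finset.sum_congr rfl fun k _ => ?_
        ext z
        simp
      map_smul' := by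
        intro c v
        rw [Finset.smul_sum]
        refine Finset.sum_congr rfl fun k _ => ?_
        ext z
        simp }

lemma pairing_apply {n : ℕ} (v w : Config n) : pairing n v w = ∑ k, inner ℝ (v k) (w k) := by
  simp [pairing]

lemma pairing_single {n : ℕ} (i : Fin n) (u : Plane) (w : Config n) :
    pairing n (Pi.single i u) w = inner ℝ u (w i) := by
  rw [pairing_apply, Finset.sum_eq_single i]
  · simp
  · intro k _ hk
    simp [hk]
  · simp

lemma pairGrad_swap {n : ℕ} (f : ℝ → ℝ → ℝ) (q : Plane) (p : Config n) (i j : Fin n) :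
    pairGrad f q p i j = pairGrad f q p j i := add_comm _ _

lemma pairGrad_apply_fst {n : ℕ} (f : ℝ → ℝ → ℝ) (q : Plane) (p : Config n) {i j : Fin n}
    (h : i ≠ j) :
    pairGrad f q p i j i = pd f (dist q (p i)) (dist q (p j)) • unitTo q (p i) := by
  simp [pairGrad, h]

lemma pairGrad_apply_of_ne {n : ℕ} (f : ℝ → ℝ → ℝ) (q : Plane) (p : Config n) {i j k : Fin n}
    (h : k ≠ i) (h' : k ≠ j) : pairGrad f q p i j k = 0 := by
  simp [pairGrad, h, h']

lemma hasFDerivAt_pairCost {n : ℕ} {f : ℝ → ℝ → ℝ} (hf : IsSensingCost f) {q : Plane}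
    {p : Config n} {i j : Fin n} (hi : q ≠ p i) (hj : q ≠ p j) :
    HasFDerivAt (fun p : Config n => f (dist q (p i)) (dist q (p j)))
      (pairing n (pairGrad f q p i j)) p := by
  have h1 : ∀ k, q ≠ p k → HasFDerivAt (fun p : Config n => dist q (p k))
      ((innerSL ℝ (unitTo q (p k))).comp (ContinuousLinearMap.proj k)) p := fun k hk =>
    (hasFDerivAt_dist_right hk).comp p (hasFDerivAt_apply k p)
  have h2 := (hf.hasFDerivAt (dist_pos.2 hi) (dist_pos.2 hj)).comp p
    (f := fun p : Config n => (dist q (p i), dist q (p j))) ((h1 i hi).prodMk (h1 j hj))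
  refine h2.congr_fderiv ?_
  ext w
  rw [pairGrad, map_add, _root_.add_apply, pairing_single, pairing_single]
  simp [inner_smul_left]

/-- `q` is not the position of an agent, and equidistant only from agents at the same position. -/
def IsGenericFor {n : ℕ} (q : Plane) (p : Config n) : Prop :=
  (∀ i, q ≠ p i) ∧ ∀ i j, p i ≠ p j → dist q (p i) ≠ dist q (p j)

/-- The factor `c` kills the partial derivatives of the cost in the position of an agent of a
nearest pair that could be exchanged with an agent at the same position. -/
def IsExchangeNull {n : ℕ} (f : ℝ → ℝ → ℝ) (c : ℝ) (q : Plane) (p : Config n) : Prop :=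
  ∀ i j k, IsNearestPair (fun l => dist q (p l)) i j → k ≠ i → k ≠ j → p k = p i →
    c * pd f (dist q (p i)) (dist q (p j)) = 0

lemma IsExchangeNull.of_injective {n : ℕ} (f : ℝ → ℝ → ℝ) (c : ℝ) (q : Plane) {p : Config n}
    (hp : Function.Injective p) : IsExchangeNull f c q p :=
  fun _ _ _ _ hki _ h => absurd (hp h) hki

/-- An agent in both pairs has partners at equal distance, because the sums agree. An agent in only
one pair is tied with an outside agent, which by genericity sits at the same position, so its
component is killed by `c`. -/
lemma smul_pairGrad_eq {n : ℕ} {f : ℝ → ℝ → ℝ} {c : ℝ} {q : Plane} {p : Config n}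
    (hg : IsGenericFor q p) (hc : IsExchangeNull f c q p) {i j a b : Fin n}
    (h : IsNearestPair (fun l => dist q (p l)) i j)
    (h' : IsNearestPair (fun l => dist q (p l)) a b) :
    c • pairGrad f q p i j = c • pairGrad f q p a b := by
  have key : ∀ {i j a b k : Fin n}, IsNearestPair (fun l => dist q (p l)) i j →
      IsNearestPair (fun l => dist q (p l)) a b → k = i →
      (c • pairGrad f q p i j) k = (c • pairGrad f q p a b) k := by
    rintro i j a b k h h' rfl
    have hs := h.sum_eq h'
    rw [Pi.smul_apply, Pi.smul_apply, pairGrad_apply_fst _ _ _ h.1]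
    by_cases ha : k = a
    · subst ha
      rw [pairGrad_apply_fst _ _ _ h'.1, add_left_cancel hs]
    · by_cases hb : k = b
      · subst hb
        rw [pairGrad_swap, pairGrad_apply_fst _ _ _ h'.1.symm,
          show dist q (p j) = dist q (p a) by linarith]
      · obtain ⟨e, h1, h2, h3⟩ := h.exists_eq_of_not_mem h' ha hb
        have h4 : p e = p k := by
          by_contra h5
          exact hg.2 _ _ h5 h3
        rw [pairGrad_apply_of_ne _ _ _ ha hb, smul_smul, hc _ _ _ h h1 h2 h4]
        simp
  funext k
  by_cases h1 : k = i
  · exact key h h' h1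
  by_cases h2 : k = j
  · rw [pairGrad_swap f q p i j]
    exact key h.swap h' h2
  by_cases h3 : k = a
  · exact (key h' h h3).symm
  by_cases h4 : k = b
  · rw [pairGrad_swap f q p a b]
    exact (key h'.swap h h4).symm
  rw [Pi.smul_apply, Pi.smul_apply, pairGrad_apply_of_ne _ _ _ h1 h2,
    pairGrad_apply_of_ne _ _ _ h3 h4]

/-- The integrand of the performance function, without the density. -/
noncomputable def minCost {n : ℕ} (f : ℝ → ℝ → ℝ) (q : Plane) (p : Config n) : ℝ :=
  ⨅ c : {c : Fin n × Fin n // c.1 < c.2}, f (dist q (p c.1.1)) (dist q (p c.1.2))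

lemma minCost_eq {n : ℕ} {f : ℝ → ℝ → ℝ} (hf : IsSensingCost f) {q : Plane} {p : Config n}
    (hq : ∀ i, q ≠ p i) {i j : Fin n} (h : IsNearestPair (fun l => dist q (p l)) i j) :
    minCost f q p = f (dist q (p i)) (dist q (p j)) := by
  have hpos : ∀ k, 0 < dist q (p k) := fun k => dist_pos.2 (hq k)
  apply le_antisymm
  · rcases lt_or_gt_of_ne h.1 with hij | hij
    · exact ciInf_le (Set.finite_range _).bddBelow
        (⟨(i, j), hij⟩ : {c : Fin n × Fin n // c.1 < c.2})
    · rw [hf.symm _ _ dist_nonneg dist_nonneg]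
      exact ciInf_le (Set.finite_range _).bddBelow
        (⟨(j, i), hij⟩ : {c : Fin n × Fin n // c.1 < c.2})
  · have : Nonempty {c : Fin n × Fin n // c.1 < c.2} := by
      rcases lt_or_gt_of_ne h.1 with hij | hij
      · exact ⟨⟨(i, j), hij⟩⟩
      · exact ⟨⟨(j, i), hij⟩⟩
    apply le_ciInf
    rintro ⟨⟨a, b⟩, hab⟩
    have hab' : a ≠ b := ne_of_lt hab
    simp only
    have hsymm : f (dist q (p i)) (dist q (p j)) = f (dist q (p j)) (dist q (p i)) :=
      hf.symm _ _ dist_nonneg dist_nonneg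
    by_cases h1 : a = i
    · subst h1
      by_cases h2 : b = j
      · rw [h2]
      · exact hf.mono (hpos _) (hpos _) le_rfl (h.2 b hab'.symm h2).2
    by_cases h2 : a = j
    · subst h2
      rw [hsymm]
      by_cases h3 : b = i
      · rw [h3]
      · exact hf.mono (hpos _) (hpos _) le_rfl (h.2 b h3 hab'.symm).1
    have ha := h.2 a h1 h2
    by_cases h3 : b = i
    · subst h3
      rw [hsymm]
      exact hf.mono (hpos _) (hpos _) ha.2 le_rfl
    by_cases h4 : b = j
    · subst h4
      exact hf.mono (hpos _) (hpos _) ha.1 le_rfl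
    exact hf.mono (hpos _) (hpos _) ha.1 (h.2 b h3 h4).2

/-- Strict inequalities between distances persist near `p`: ties may break, but no order is
reversed. -/
lemma eventually_isNearestPair_imp {n : ℕ} (q : Plane) (p : Config n) :
    ∀ᶠ y in 𝓝 p, ∀ i j, IsNearestPair (fun l => dist q (y l)) i j →
      IsNearestPair (fun l => dist q (p l)) i j := by
  have h : ∀ i j, ∀ᶠ y : Config n in 𝓝 p, dist q (p i) < dist q (p j) →
      dist q (y i) < dist q (y j) := by
    intro i j
    by_cases hij : dist q (p i) < dist q (p j)
    · have h1 : ContinuousAt (fun y : Config n => dist q (y i)) p :=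
        (continuous_const.dist (continuous_apply i)).continuousAt
      have h2 : ContinuousAt (fun y : Config n => dist q (y j)) p :=
        (continuous_const.dist (continuous_apply j)).continuousAt
      filter_upwards [h1.eventually_lt h2 hij] with y hy _ using hy
    · exact Eventually.of_forall fun y h' => absurd h' hij
  have h' := eventually_all.2 fun i => eventually_all.2 (h i)
  filter_upwards [h'] with y hy i j hij
  refine ⟨hij.1, fun w hwi hwj => ⟨?_, ?_⟩⟩
  · by_contra hc
    exact absurd (hij.2 w hwi hwj).1 (not_le.2 (hy w i (not_le.1 hc)))
  · by_contra hc
    exact absurd (hij.2 w hwi hwj).2 (not_le.2 (hy w j (not_le.1 hc)))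

lemma eventually_forall_ne {n : ℕ} {q : Plane} {p : Config n} (hq : ∀ i, q ≠ p i) :
    ∀ᶠ y in 𝓝 p, ∀ i, q ≠ y i := by
  refine eventually_all.2 fun i => ?_
  have h1 : ContinuousAt (fun y : Config n => y i) p := (continuous_apply i).continuousAt
  filter_upwards [h1.eventually_ne (hq i).symm] with y hy using hy.symm

lemma continuousAt_pairGrad {n : ℕ} {f : ℝ → ℝ → ℝ} (hf : IsSensingCost f) {q : Plane}
    {p : Config n} {i j : Fin n} (hi : q ≠ p i) (hj : q ≠ p j) :
    ContinuousAt (fun y : Config n => pairGrad f q y i j) p := by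
  have h1 : ∀ k, q ≠ p k → ContinuousAt (fun y : Config n => unitTo q (y k)) p := fun k hk =>
    ContinuousAt.comp (f := fun y : Config n => (q, y k)) (g := fun z : Plane × Plane =>
      unitTo z.1 z.2) (continuousAt_unitTo hk)
      (continuousAt_const.prodMk (continuous_apply k).continuousAt)
  have h2 : ∀ k l, q ≠ p k → q ≠ p l →
      ContinuousAt (fun y : Config n => pd f (dist q (y k)) (dist q (y l))) p :=
    fun k l hk hl => ContinuousAt.comp (f := fun y : Config n => (dist q (y k), dist q (y l)))
      (g := fun z : ℝ × ℝ => pd f z.1 z.2)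
      (hf.continuousAt_pd (dist_pos.2 hk) (dist_pos.2 hl))
      ((continuous_const.dist (continuous_apply k)).prodMk
        (continuous_const.dist (continuous_apply l))).continuousAt
  have hs : ∀ k, Continuous (fun u : Plane => (Pi.single k u : Config n)) := fun k =>
    continuous_single (A := fun _ : Fin n => Plane) k
  exact ((hs i).continuousAt.comp ((h2 i j hi hj).smul (h1 i hi))).add
    ((hs j).continuousAt.comp ((h2 j i hj hi).smul (h1 j hj)))

/-- Near `p` the minimum is attained by one of the finitely many pairs nearest at `p`. Their costs
agree at `p` and, times `c`, have the same derivative there, so one first-order estimate covers them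
all. -/
lemma hasFDerivAt_minCost {n : ℕ} {f : ℝ → ℝ → ℝ} (hn : 2 ≤ n) (hf : IsSensingCost f) {c : ℝ}
    {q : Plane} {p : Config n} (hg : IsGenericFor q p) (hc : IsExchangeNull f c q p)
    {i j : Fin n} (h : IsNearestPair (fun l => dist q (p l)) i j) :
    HasFDerivAt (fun y : Config n => minCost f q y * c) (pairing n (c • pairGrad f q p i j)) p := by
  have hpair : ∀ a b, IsNearestPair (fun l => dist q (p l)) a b →
      HasFDerivAt (fun y : Config n => f (dist q (y a)) (dist q (y b)) * c)
        (pairing n (c • pairGrad f q p i j)) p := by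
    intro a b hab
    rw [smul_pairGrad_eq hg hc h hab, map_smul]
    exact (hasFDerivAt_pairCost hf (hg.1 a) (hg.1 b)).mul_const c
  rw [hasFDerivAt_iff_isLittleO, Asymptotics.isLittleO_iff]
  intro ε hε
  have h1 : ∀ a b, ∀ᶠ y in 𝓝 p, IsNearestPair (fun l => dist q (p l)) a b →
      ‖f (dist q (y a)) (dist q (y b)) * c - f (dist q (p a)) (dist q (p b)) * c -
        (pairing n (c • pairGrad f q p i j)) (y - p)‖ ≤ ε * ‖y - p‖ := by
    intro a b
    by_cases hab : IsNearestPair (fun l => dist q (p l)) a b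
    · have h2 := hpair a b hab
      rw [hasFDerivAt_iff_isLittleO, Asymptotics.isLittleO_iff] at h2
      filter_upwards [h2 hε] with y hy _ using hy
    · exact Eventually.of_forall fun y h' => absurd h' hab
  filter_upwards [eventually_all.2 fun a => eventually_all.2 (h1 a),
    eventually_isNearestPair_imp q p, eventually_forall_ne hg.1] with y hy1 hy2 hy3
  obtain ⟨a, b, hab⟩ := IsNearestPair.exists_isNearestPair hn (fun l => dist q (y l))
  have := hy1 a b (hy2 a b hab)
  rwa [minCost_eq hf hy3 hab, minCost_eq hf hg.1 (hy2 a b hab)]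

/-- The integrand of the gradient of the performance function, without the density. -/
noncomputable def gradIntegrand {n : ℕ} (Q : Set Plane) (f : ℝ → ℝ → ℝ) (p : Config n)
    (q : Plane) : Config n := fun i =>
  ∑ j ∈ Finset.univ.erase i, (voronoiCell Q p {i, j}).indicator
    (fun q => gradient (fun x : Plane => f (dist q x) (dist q (p j))) (p i)) q

lemma gradient_cost {f : ℝ → ℝ → ℝ} (hf : IsSensingCost f) {q x y : Plane} (hx : q ≠ x)
    (hy : q ≠ y) : gradient (fun x : Plane => f (dist q x) (dist q y)) x =
      pd f (dist q x) (dist q y) • unitTo q x := by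
  have h1 : HasDerivAt (fun s => f s (dist q y)) (pd f (dist q x) (dist q y)) (dist q x) :=
    (DifferentiableAt.comp _ (f := fun s : ℝ => (s, dist q y))
      (hf.differentiableAt (dist_pos.2 hx) (dist_pos.2 hy)) (by fun_prop)).hasDerivAt
  have h2 := h1.comp_hasFDerivAt x (hasFDerivAt_dist_right hx)
  apply HasGradientAt.gradient
  rw [hasGradientAt_iff_hasFDerivAt]
  refine h2.congr_fderiv ?_
  ext w
  simp

/-- With distinct positions a generic point has no ties, hence lies in the cell of only one pair,
and the sums over cells collapse. -/
lemma gradIntegrand_eq_pairGrad {n : ℕ} {Q : Set Plane} {f : ℝ → ℝ → ℝ} (hf : IsSensingCost f)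
    {p : Config n} {q : Plane} (hq : q ∈ Q) (hg : IsGenericFor q p) (hp : Function.Injective p)
    {i j : Fin n} (h : IsNearestPair (fun l => dist q (p l)) i j) :
    gradIntegrand Q f p q = pairGrad f q p i j := by
  have key : ∀ {i j : Fin n}, IsNearestPair (fun l => dist q (p l)) i j →
      gradIntegrand Q f p q i = pairGrad f q p i j i := by
    intro i j h
    rw [gradIntegrand, Finset.sum_eq_single j, Set.indicator_of_mem,
      pairGrad_apply_fst _ _ _ h.1, gradient_cost hf (hg.1 i) (hg.1 j)]
    · rw [mem_voronoiCell_pair h.1]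
      exact ⟨hq, h⟩
    · intro k hk hkj
      apply Set.indicator_of_notMem
      rw [mem_voronoiCell_pair (Finset.ne_of_mem_erase hk).symm]
      rintro ⟨-, h'⟩
      have hs := h.sum_eq h'
      exact hg.2 j k (hp.ne hkj.symm) (add_left_cancel hs)
    · intro hj
      exact absurd (Finset.mem_erase.2 ⟨h.1.symm, Finset.mem_univ _⟩) hj
  funext k
  by_cases h1 : k = i
  · subst h1
    exact key h
  by_cases h2 : k = j
  · subst h2
    rw [pairGrad_swap]
    exact key h.swap
  rw [pairGrad_apply_of_ne _ _ _ h1 h2, gradIntegrand]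
  apply Finset.sum_eq_zero
  intro l hl
  apply Set.indicator_of_notMem
  rw [mem_voronoiCell_pair (Finset.ne_of_mem_erase hl).symm]
  rintro ⟨-, h'⟩
  obtain ⟨e, he1, -, he3⟩ := h'.exists_eq_of_not_mem h h1 h2
  exact hg.2 e k (hp.ne he1) he3

/-- For large `k` the nearest pair of `p k` is also nearest for `x`, and at `x` all nearest pairs
have the same scaled gradient. -/
lemma tendsto_smul_gradIntegrand {n : ℕ} (hn : 2 ≤ n) {Q : Set Plane} {f : ℝ → ℝ → ℝ}
    (hf : IsSensingCost f) {c : ℝ} {x : Config n} {p : ℕ → Config n} (hp : Tendsto p atTop (𝓝 x))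
    (hinj : ∀ k, Function.Injective (p k)) {q : Plane} (hq : q ∈ Q) (hg : IsGenericFor q x)
    (hgp : ∀ k, IsGenericFor q (p k)) (hc : IsExchangeNull f c q x) {i j : Fin n}
    (h : IsNearestPair (fun l => dist q (x l)) i j) :
    Tendsto (fun k => c • gradIntegrand Q f (p k) q) atTop (𝓝 (c • pairGrad f q x i j)) := by
  rw [Metric.tendsto_nhds]
  intro ε hε
  have h1 : ∀ a b, ∀ᶠ y in 𝓝 x, IsNearestPair (fun l => dist q (x l)) a b →
      dist (c • pairGrad f q y a b) (c • pairGrad f q x i j) < ε := by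
    intro a b
    by_cases hab : IsNearestPair (fun l => dist q (x l)) a b
    · rw [smul_pairGrad_eq hg hc h hab]
      have h2 : ContinuousAt (fun y => c • pairGrad f q y a b) x :=
        (continuousAt_pairGrad hf (hg.1 a) (hg.1 b)).const_smul c
      filter_upwards [Metric.tendsto_nhds.1 h2 ε hε] with y hy _ using hy
    · exact Eventually.of_forall fun y h' => absurd h' hab
  filter_upwards [hp.eventually (eventually_all.2 fun a => eventually_all.2 (h1 a)),
    hp.eventually (eventually_isNearestPair_imp q x)] with k hk1 hk2
  obtain ⟨a, b, hab⟩ := IsNearestPair.exists_isNearestPair hn (fun l => dist q (p k l))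
  rw [gradIntegrand_eq_pairGrad hf hq (hgp k) (hinj k) hab]
  exact hk1 a b (hk2 a b hab)

/-! ### Null sets, uniform bounds, and the gradient as one integral over `Q` -/

lemma volume_setOf_inner_eq {e : Plane} (he : e ≠ 0) (c : ℝ) :
    volume {q : Plane | inner ℝ e q = c} = 0 := by
  let s : AffineSubspace ℝ Plane := (AffineSubspace.mk' (c : ℝ) ⊥).comap
    (innerSL ℝ e).toLinearMap.toAffineMap
  have hs : (s : Set Plane) = {q : Plane | inner ℝ e q = c} := by
    ext q
    simp [s, sub_eq_zero]
  rw [← hs]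
  apply Measure.addHaar_affineSubspace
  intro htop
  have h1 : ∀ q : Plane, inner ℝ e q = c := fun q => by
    have : q ∈ (s : Set Plane) := by rw [htop]; trivial
    rwa [hs] at this
  have h2 := h1 0
  have h3 := h1 e
  rw [inner_zero_right] at h2
  rw [← h2, inner_self_eq_zero] at h3
  exact he h3

lemma dist_sq_sub_dist_sq (q y z : Plane) :
    dist q y ^ 2 - dist q z ^ 2 = inner ℝ (y - z) (y + z - (2 : ℝ) • q) := by
  rw [dist_eq_norm, dist_eq_norm, ← real_inner_self_eq_norm_sq, ← real_inner_self_eq_norm_sq]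
  simp only [inner_sub_left, inner_sub_right, inner_add_right, real_inner_smul_right,
    real_inner_comm]
  ring

lemma volume_setOf_dist_eq {y z : Plane} (h : y ≠ z) :
    volume {q : Plane | dist q y = dist q z} = 0 := by
  refine measure_mono_null ?_
    (volume_setOf_inner_eq (sub_ne_zero.2 h) (inner ℝ (y - z) (y + z) / 2))
  intro q hq
  have h1 := dist_sq_sub_dist_sq q y z
  rw [Set.mem_ofPred_eq] at hq ⊢
  rw [hq, sub_self, inner_sub_right, real_inner_smul_right] at h1
  linarith

lemma ae_isGenericFor {n : ℕ} (p : Config n) : ∀ᵐ q : Plane, IsGenericFor q p := by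
  have h1 : ∀ᵐ q : Plane, ∀ i, q ≠ p i := by
    rw [ae_all_iff]
    intro i
    exact Measure.ae_ne volume (p i)
  have h2 : ∀ᵐ q : Plane, ∀ i j, p i ≠ p j → dist q (p i) ≠ dist q (p j) := by
    rw [ae_all_iff]
    intro i
    rw [ae_all_iff]
    intro j
    by_cases hij : p i = p j
    · exact Eventually.of_forall fun q h => absurd hij h
    · filter_upwards [measure_eq_zero_iff_ae_notMem.1 (volume_setOf_dist_eq hij)] with q hq _
      exact hq
  filter_upwards [h1, h2] with q hq1 hq2 using ⟨hq1, hq2⟩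

lemma nonempty_pairs {n : ℕ} (hn : 2 ≤ n) : Nonempty {c : Fin n × Fin n // c.1 < c.2} :=
  ⟨⟨(⟨0, by omega⟩, ⟨1, by omega⟩), by simp⟩⟩

lemma exists_minCost_eq {n : ℕ} (hn : 2 ≤ n) (f : ℝ → ℝ → ℝ) (q : Plane) (p : Config n) :
    ∃ i j, minCost f q p = f (dist q (p i)) (dist q (p j)) := by
  have := nonempty_pairs hn
  obtain ⟨c, hc⟩ := exists_eq_ciInf_of_finite
    (f := fun c : {c : Fin n × Fin n // c.1 < c.2} => f (dist q (p c.1.1)) (dist q (p c.1.2)))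
  exact ⟨_, _, hc.symm⟩

lemma continuous_cost {f : ℝ → ℝ → ℝ} (hf : IsSensingCost f) (y z : Plane) :
    Continuous (fun q => f (dist q y) (dist q z)) := by
  have h := hf.continuousOn.comp_continuous (f := fun q : Plane => (dist q y, dist q z))
    ((continuous_id.dist continuous_const).prodMk (continuous_id.dist continuous_const))
    (fun q => ⟨dist_nonneg, dist_nonneg⟩)
  exact h

lemma continuous_minCost {n : ℕ} (hn : 2 ≤ n) {f : ℝ → ℝ → ℝ} (hf : IsSensingCost f)
    (p : Config n) : Continuous (fun q => minCost f q p) := by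
  have := nonempty_pairs hn
  have e : (fun q => minCost f q p) = fun q => Finset.univ.inf' Finset.univ_nonempty
      (fun c : {c : Fin n × Fin n // c.1 < c.2} =>
        f (dist q (p c.1.1)) (dist q (p c.1.2))) := by
    funext q
    rw [Finset.inf'_univ_eq_ciInf]
    rfl
  rw [e]
  exact Continuous.finset_inf'_apply _ fun c _ => continuous_cost hf _ _

lemma abs_dist_sub_dist_le {n : ℕ} (q : Plane) (y z : Config n) (i : Fin n) :
    dist (dist q (y i)) (dist q (z i)) ≤ ‖y - z‖ := by
  rw [dist_comm q, dist_comm q]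
  refine (dist_dist_dist_le_left _ _ _).trans ?_
  rw [dist_eq_norm]
  exact norm_le_pi_norm (y - z) i

lemma minCost_sub_le {n : ℕ} (hn : 2 ≤ n) {f : ℝ → ℝ → ℝ} {R : ℝ} {K : NNReal}
    (hK : LipschitzOnWith K (fun z : ℝ × ℝ => f z.1 z.2) (Icc 0 R ×ˢ Icc 0 R))
    {q : Plane} {y z : Config n} (hy : ∀ i, dist q (y i) ≤ R) (hz : ∀ i, dist q (z i) ≤ R) :
    minCost f q y - minCost f q z ≤ K * ‖y - z‖ := by
  have := nonempty_pairs hn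
  rw [sub_le_comm]
  apply le_ciInf
  intro c
  have h1 : minCost f q y ≤ f (dist q (y c.1.1)) (dist q (y c.1.2)) :=
    ciInf_le (Set.finite_range _).bddBelow c
  have h2 := hK.dist_le_mul (dist q (y c.1.1), dist q (y c.1.2))
    ⟨⟨dist_nonneg, hy _⟩, ⟨dist_nonneg, hy _⟩⟩ (dist q (z c.1.1), dist q (z c.1.2))
    ⟨⟨dist_nonneg, hz _⟩, ⟨dist_nonneg, hz _⟩⟩
  have h3 : dist (dist q (y c.1.1), dist q (y c.1.2)) (dist q (z c.1.1), dist q (z c.1.2)) ≤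
      ‖y - z‖ := max_le (abs_dist_sub_dist_le _ _ _ _) (abs_dist_sub_dist_le _ _ _ _)
  have h4 := h2.trans (mul_le_mul_of_nonneg_left h3 K.2)
  have h5 := (abs_le.1 ((Real.dist_eq _ _).symm.trans_le h4)).2
  simp only at h5
  linarith

lemma dist_le_two_mul {n : ℕ} {R : ℝ} {q : Plane} (hq : ‖q‖ ≤ R) {y : Config n} (hy : ‖y‖ ≤ R)
    (i : Fin n) : dist q (y i) ≤ 2 * R := by
  have := norm_le_pi_norm y i
  have := dist_le_norm_add_norm q (y i)
  linarith

/-- Uniform bounds for the cost, its partial derivatives and its Lipschitz constant, for points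
and agents in a ball. -/
lemma exists_uniform_bound {n : ℕ} (hn : 2 ≤ n) {f : ℝ → ℝ → ℝ} (hf : IsSensingCost f) (R : ℝ) :
    ∃ K : ℝ, 0 ≤ K ∧ ∀ q : Plane, ‖q‖ ≤ R → ∀ y : Config n, ‖y‖ ≤ R →
      (∀ z : Config n, ‖z‖ ≤ R → |minCost f q y - minCost f q z| ≤ K * ‖y - z‖) ∧
      |minCost f q y| ≤ K ∧
      ((∀ i, q ≠ y i) → ∀ i j, |pd f (dist q (y i)) (dist q (y j))| ≤ K) := by
  -- Distances are at most `2 * R`; the extra `1` keeps them strictly inside the interval, as the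
  -- bound on `pd` requires.
  obtain ⟨K, hK⟩ := hf.exists_lipschitz (2 * R + 1)
  obtain ⟨C, hC⟩ := (isCompact_Icc.prod isCompact_Icc).exists_bound_of_continuousOn
    (hf.continuousOn.mono (prod_mono (Icc_subset_Ici_self : Icc 0 (2 * R + 1) ⊆ Ici 0)
      (Icc_subset_Ici_self : Icc 0 (2 * R + 1) ⊆ Ici 0)))
  refine ⟨max (K : ℝ) C, le_max_of_le_left K.2, fun q hq y hy => ⟨fun z hz => ?_, ?_, fun hne i j => ?_⟩⟩
  · have hy' : ∀ i, dist q (y i) ≤ 2 * R + 1 := fun i => by linarith [dist_le_two_mul hq hy i]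
    have hz' : ∀ i, dist q (z i) ≤ 2 * R + 1 := fun i => by linarith [dist_le_two_mul hq hz i]
    have h1 := minCost_sub_le hn hK hy' hz'
    have h2 := minCost_sub_le hn hK hz' hy'
    rw [norm_sub_rev z y] at h2
    have h3 : (K : ℝ) * ‖y - z‖ ≤ max (K : ℝ) C * ‖y - z‖ :=
      mul_le_mul_of_nonneg_right (le_max_left _ _) (norm_nonneg _)
    exact abs_le.2 ⟨by linarith, by linarith⟩
  · obtain ⟨i, j, hij⟩ := exists_minCost_eq hn f q y
    rw [hij]
    refine le_trans ?_ (le_max_right (K : ℝ) C)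
    exact hC (dist q (y i), dist q (y j))
      ⟨⟨dist_nonneg, by linarith [dist_le_two_mul hq hy i]⟩,
        ⟨dist_nonneg, by linarith [dist_le_two_mul hq hy j]⟩⟩
  · refine le_trans ?_ (le_max_left (K : ℝ) C)
    exact abs_pd_le_of_lipschitzOnWith hK (dist_pos.2 (hne i)) (dist_pos.2 (hne j))
      (by linarith [dist_le_two_mul hq hy i]) (by linarith [dist_le_two_mul hq hy j])

lemma isClosed_voronoiCell {n : ℕ} {Q : Set Plane} (hQ : IsClosed Q) (p : Config n)
    (T : Finset (Fin n)) : IsClosed (voronoiCell Q p T) := by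
  have e : voronoiCell Q p T = Q ∩ ⋂ v ∈ T, ⋂ w ∈ {w | w ∉ T},
      {q | dist q (p v) ≤ dist q (p w)} := by
    ext q
    simp [voronoiCell]
  rw [e]
  refine hQ.inter (isClosed_biInter fun v _ => isClosed_biInter fun w _ => ?_)
  exact isClosed_le (continuous_id.dist continuous_const) (continuous_id.dist continuous_const)

lemma voronoiCell_subset {n : ℕ} {Q : Set Plane} (p : Config n) (T : Finset (Fin n)) :
    voronoiCell Q p T ⊆ Q := fun _ h => h.1

lemma aestronglyMeasurable_gradient_cost {f : ℝ → ℝ → ℝ} (hf : IsSensingCost f) (x y : Plane) :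
    AEStronglyMeasurable
      (fun q : Plane => gradient (fun x : Plane => f (dist q x) (dist q y)) x) volume := by
  have ho : IsOpen ({x, y}ᶜ : Set Plane) := (Set.toFinite {x, y}).isClosed.isOpen_compl
  have hc : ContinuousOn (fun q : Plane => pd f (dist q x) (dist q y) • unitTo q x)
      ({x, y}ᶜ : Set Plane) := by
    intro q hq
    simp only [mem_compl_iff, mem_insert_iff, mem_singleton_iff, not_or] at hq
    apply ContinuousAt.continuousWithinAt
    refine ContinuousAt.smul (f := fun q : Plane => pd f (dist q x) (dist q y))
      (g := fun q : Plane => unitTo q x) ?_ ?_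
    · exact ContinuousAt.comp (f := fun q : Plane => (dist q x, dist q y))
        (g := fun z : ℝ × ℝ => pd f z.1 z.2)
        (hf.continuousAt_pd (dist_pos.2 hq.1) (dist_pos.2 hq.2))
        ((continuous_id.dist continuous_const).prodMk
          (continuous_id.dist continuous_const)).continuousAt
    · exact ContinuousAt.comp (f := fun q : Plane => (q, x))
        (g := fun z : Plane × Plane => unitTo z.1 z.2) (continuousAt_unitTo hq.1)
        (continuous_id.prodMk continuous_const).continuousAt
  have h1 := hc.aestronglyMeasurable (μ := volume) ho.measurableSet
  have h2 : volume.restrict ({x, y}ᶜ : Set Plane) = (volume : Measure Plane) := by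
    rw [Measure.restrict_eq_self_of_ae_mem]
    exact measure_eq_zero_iff_ae_notMem.1 ((Set.toFinite {x, y}).measure_zero volume)
  rw [h2] at h1
  refine h1.congr ?_
  filter_upwards [Measure.ae_ne volume x, Measure.ae_ne volume y] with q hx hy
  exact (gradient_cost hf hx hy).symm

lemma norm_gradIntegrand_le {n : ℕ} (Q : Set Plane) {f : ℝ → ℝ → ℝ} (hf : IsSensingCost f)
    {p : Config n} {q : Plane} (hq : ∀ i, q ≠ p i) {K : ℝ} (hK0 : 0 ≤ K)
    (hK : ∀ i j, |pd f (dist q (p i)) (dist q (p j))| ≤ K) :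
    ‖gradIntegrand Q f p q‖ ≤ n * K := by
  rw [pi_norm_le_iff_of_nonneg (by positivity)]
  intro i
  refine (norm_sum_le _ _).trans ?_
  refine (Finset.sum_le_card_nsmul _ _ K ?_).trans ?_
  · intro j _
    refine (norm_indicator_le_norm_self _ _).trans ?_
    rw [gradient_cost hf (hq i) (hq j), norm_smul]
    calc _ ≤ K * 1 := mul_le_mul (hK i j) (norm_unitTo_le _ _) (norm_nonneg _) hK0
      _ = K := mul_one K
  · rw [nsmul_eq_mul]
    refine mul_le_mul_of_nonneg_right ?_ hK0
    have := Finset.card_le_univ (Finset.univ.erase i)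
    rw [Fintype.card_fin] at this
    exact_mod_cast this

lemma aestronglyMeasurable_gradIntegrand {n : ℕ} {Q : Set Plane} (hQ : IsClosed Q)
    {f : ℝ → ℝ → ℝ} (hf : IsSensingCost f) (p : Config n) :
    AEStronglyMeasurable (gradIntegrand Q f p) volume := by
  refine (aemeasurable_pi_iff.2 ?_).aestronglyMeasurable
  intro i
  refine AEStronglyMeasurable.aemeasurable ?_
  apply Finset.aestronglyMeasurable_fun_sum
  intro j _
  exact (aestronglyMeasurable_gradient_cost hf _ _).indicator
    (isClosed_voronoiCell hQ _ _).measurableSet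

lemma integrable_smul_of_ae_bound {E : Type*} [NormedAddCommGroup E] [NormedSpace ℝ E]
    {μ : Measure Plane} {φ : Plane → ℝ} (hφ : Integrable φ μ) {g : Plane → E}
    (hg : AEStronglyMeasurable g μ) {C : ℝ} (hC : ∀ᵐ q ∂μ, ‖g q‖ ≤ C) :
    Integrable (fun q => φ q • g q) μ := by
  refine Integrable.mono' (hφ.norm.mul_const C) (hφ.aestronglyMeasurable.smul hg) ?_
  filter_upwards [hC] with q hq
  rw [norm_smul]
  exact mul_le_mul_of_nonneg_left hq (norm_nonneg _)

lemma cellGradient_eq_integral {n : ℕ} (hn : 2 ≤ n) {Q : Set Plane} (hQ : IsCompact Q)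
    {φ : Plane → ℝ} (hφ : IntegrableOn φ Q) {f : ℝ → ℝ → ℝ} (hf : IsSensingCost f)
    (p : Config n) :
    Integrable (fun q => φ q • gradIntegrand Q f p q) (volume.restrict Q) ∧
    cellGradient Q φ f p = ∫ q in Q, φ q • gradIntegrand Q f p q := by
  obtain ⟨R, hR⟩ := hQ.isBounded.exists_norm_le
  obtain ⟨K, hK0, hK⟩ := exists_uniform_bound hn hf (max R ‖p‖)
  have hbd : ∀ᵐ q ∂(volume.restrict Q), (∀ i, q ≠ p i) ∧
      ∀ i j, |pd f (dist q (p i)) (dist q (p j))| ≤ K := by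
    filter_upwards [ae_restrict_of_ae (ae_isGenericFor p),
      ae_restrict_mem hQ.measurableSet] with q hq1 hq2
    exact ⟨hq1.1, (hK q ((hR q hq2).trans (le_max_left _ _)) p (le_max_right _ _)).2.2 hq1.1⟩
  have hint : Integrable (fun q => φ q • gradIntegrand Q f p q) (volume.restrict Q) := by
    refine integrable_smul_of_ae_bound (C := n * K) hφ
      (aestronglyMeasurable_gradIntegrand hQ.isClosed hf p).restrict ?_
    filter_upwards [hbd] with q hq
    exact norm_gradIntegrand_le Q hf hq.1 hK0 hq.2
  refine ⟨hint, ?_⟩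
  funext i
  rw [eval_integral (fun i => hint.eval i)]
  simp only [Pi.smul_apply, gradIntegrand, Finset.smul_sum]
  rw [integral_finsetSum]
  · refine Finset.sum_congr rfl fun j _ => ?_
    have hm := (isClosed_voronoiCell hQ.isClosed p {i, j}).measurableSet
    have e : (fun q => φ q • (voronoiCell Q p {i, j}).indicator
        (fun q => gradient (fun x : Plane => f (dist q x) (dist q (p j))) (p i)) q) =
        (voronoiCell Q p {i, j}).indicator (fun q => φ q •
          gradient (fun x : Plane => f (dist q x) (dist q (p j))) (p i)) := by
      funext q
      by_cases hq : q ∈ voronoiCell Q p {i, j} <;> simp [hq]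
    rw [e, setIntegral_indicator hm, inter_eq_self_of_subset_right (voronoiCell_subset _ _)]
  · intro j _
    refine integrable_smul_of_ae_bound (C := K) hφ
      ((aestronglyMeasurable_gradient_cost hf _ _).indicator
        (isClosed_voronoiCell hQ.isClosed _ _).measurableSet).restrict ?_
    filter_upwards [hbd] with q hq
    refine (norm_indicator_le_norm_self _ _).trans ?_
    rw [gradient_cost hf (hq.1 i) (hq.1 j), norm_smul]
    calc _ ≤ K * 1 := mul_le_mul (hq.2 i j) (norm_unitTo_le _ _) (norm_nonneg _) hK0
      _ = K := mul_one K

/-- The upper limits are nonpositive, so the positive parts tend to zero in mean by dominated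
convergence. Since `|Φ| = 2 Φ⁺ - Φ` and the integrals of `Φ` vanish in the limit, so do those of
`|Φ|`, and a subsequence converges almost everywhere. -/
lemma exists_subseq_tendsto_zero_of_integral {α ι : Type*} [Fintype ι] [MeasurableSpace α]
    {μ : Measure α} {Φ : ι → ℕ → α → ℝ} {B : α → ℝ} (hB : Integrable B μ)
    (hm : ∀ c k, AEStronglyMeasurable (Φ c k) μ) (hb : ∀ c k, ∀ᵐ q ∂μ, |Φ c k q| ≤ B q)
    (hpos : ∀ᵐ q ∂μ, ∀ c, ∀ ε : ℝ, 0 < ε → ∀ᶠ k in atTop, Φ c k q ≤ ε)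
    (hint : ∀ c, Tendsto (fun k => ∫ q, Φ c k q ∂μ) atTop (𝓝 0)) :
    ∃ σ : ℕ → ℕ, StrictMono σ ∧
      ∀ᵐ q ∂μ, ∀ c, Tendsto (fun k => Φ c (σ k) q) atTop (𝓝 0) := by
  have hΦ : ∀ c k, Integrable (Φ c k) μ := fun c k => hB.mono' (hm c k) (hb c k)
  have h1 : ∀ c, Tendsto (fun k => ∫ q, max (Φ c k q) 0 ∂μ) atTop (𝓝 0) := by
    intro c
    have := tendsto_integral_of_dominated_convergence (F := fun k q => max (Φ c k q) 0)
      (f := fun _ => (0 : ℝ)) (μ := μ) B (fun k => (hΦ c k).pos_part.aestronglyMeasurable) hB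
      (fun k => by
        filter_upwards [hb c k] with q hq
        rw [Real.norm_eq_abs, abs_of_nonneg (le_max_right _ _)]
        exact max_le ((le_abs_self _).trans hq) ((abs_nonneg _).trans hq))
      (by
        filter_upwards [hpos] with q hq
        rw [Metric.tendsto_nhds]
        intro ε hε
        filter_upwards [hq c (ε / 2) (by positivity)] with k hk
        rw [Real.dist_eq, sub_zero, abs_of_nonneg (le_max_right _ _)]
        exact max_lt (by linarith) hε)
    simpa using this
  have h2 : ∀ c, Tendsto (fun k => ∫ q, |Φ c k q| ∂μ) atTop (𝓝 0) := by
    intro c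
    have e : ∀ k, ∫ q, |Φ c k q| ∂μ = 2 * ∫ q, max (Φ c k q) 0 ∂μ - ∫ q, Φ c k q ∂μ := by
      intro k
      rw [← integral_const_mul, ← integral_sub ((hΦ c k).pos_part.const_mul 2) (hΦ c k)]
      refine integral_congr_ae (Eventually.of_forall fun q => ?_)
      rcases le_total 0 (Φ c k q) with h | h
      · simp only [abs_of_nonneg h, max_eq_left h]; ring
      · simp only [abs_of_nonpos h, max_eq_right h]; ring
    simp_rw [e]
    simpa using ((h1 c).const_mul 2).sub (hint c)
  -- Summing over the finite index set yields one subsequence that serves every `c`.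
  let G : ℕ → α → ℝ := fun k q => ∑ c, |Φ c k q|
  have hG : ∀ k, Integrable (G k) μ := fun k => integrable_finsetSum _ fun c _ => (hΦ c k).abs
  have h3 : Tendsto (fun k => ∫ q, G k q ∂μ) atTop (𝓝 0) := by
    have e : ∀ k, ∫ q, G k q ∂μ = ∑ c, ∫ q, |Φ c k q| ∂μ := fun k =>
      integral_finsetSum _ fun c _ => (hΦ c k).abs
    simp_rw [e]
    simpa using tendsto_finsetSum Finset.univ fun c _ => h2 c
  have h4 : TendstoInMeasure μ G atTop (fun _ => (0 : ℝ)) := by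
    refine tendstoInMeasure_of_tendsto_eLpNorm one_ne_zero
      (fun k => (hG k).aestronglyMeasurable) aestronglyMeasurable_const ?_
    have e : ∀ k, eLpNorm (G k - fun _ => (0 : ℝ)) 1 μ = ENNReal.ofReal (∫ q, G k q ∂μ) := by
      intro k
      have e1 : (G k - fun _ => (0 : ℝ)) = G k := by ext; simp
      rw [e1, eLpNorm_one_eq_lintegral_enorm, ← ofReal_integral_norm_eq_lintegral_enorm (hG k)]
      congr 1
      refine integral_congr_ae (Eventually.of_forall fun q => ?_)
      exact Real.norm_of_nonneg (Finset.sum_nonneg fun c _ => abs_nonneg _)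
    simp_rw [e]
    simpa using ENNReal.tendsto_ofReal h3
  obtain ⟨σ, hσ, hlim⟩ := h4.exists_seq_tendsto_ae
  refine ⟨σ, hσ, ?_⟩
  filter_upwards [hlim] with q hq c
  refine squeeze_zero_norm (fun k => ?_) hq
  exact Finset.single_le_sum (f := fun c => |Φ c (σ k) q|) (fun c _ => abs_nonneg _)
    (Finset.mem_univ c)

/-! ### Differentiability of the performance function -/

/-- The slack in `‖x‖ + 1 ≤ R` makes room for the unit ball about `x` on which the integrand is
shown to be Lipschitz. -/
lemma exists_norm_bound {n : ℕ} {Q : Set Plane} (hQ : IsCompact Q) {x : Config n}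
    {p : ℕ → Config n} (hp : Tendsto p atTop (𝓝 x)) :
    ∃ R : ℝ, (∀ q ∈ Q, ‖q‖ ≤ R) ∧ (∀ k, ‖p k‖ ≤ R) ∧ ‖x‖ + 1 ≤ R := by
  obtain ⟨R₁, hR₁⟩ := hQ.isBounded.exists_norm_le
  obtain ⟨R₂, hR₂⟩ := (Metric.isBounded_range_of_tendsto p hp).exists_norm_le
  refine ⟨max R₁ (max R₂ (‖x‖ + 1)), fun q hq => (hR₁ q hq).trans (le_max_left _ _),
    fun k => (hR₂ _ (mem_range_self k)).trans ?_, ?_⟩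
  · exact (le_max_left _ _).trans (le_max_right _ _)
  · exact (le_max_right _ _).trans (le_max_right _ _)

lemma integrable_minCost_mul {n : ℕ} (hn : 2 ≤ n) {Q : Set Plane} (hQ : IsCompact Q)
    {φ : Plane → ℝ} (hφ : IntegrableOn φ Q) {f : ℝ → ℝ → ℝ} (hf : IsSensingCost f)
    (x : Config n) : Integrable (fun q => minCost f q x * φ q) (volume.restrict Q) := by
  have := hφ.mul_continuousOn (continuous_minCost hn hf x).continuousOn hQ
  refine this.congr (Eventually.of_forall fun q => mul_comm _ _)

/-- The performance function is differentiable at a limit of injective configurations along which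
the cell gradients converge, if exchanging agents at the same position does not matter. -/
lemma hasFDerivAt_performance_of_tendsto {n : ℕ} (hn : 2 ≤ n) {Q : Set Plane} (hQ : IsCompact Q)
    {φ : Plane → ℝ} (hφ : IntegrableOn φ Q) {f : ℝ → ℝ → ℝ} (hf : IsSensingCost f)
    {x : Config n} {p : ℕ → Config n} (hp : Tendsto p atTop (𝓝 x))
    (hinj : ∀ k, Function.Injective (p k))
    (hnull : ∀ᵐ q ∂(volume.restrict Q), IsExchangeNull f (φ q) q x) {v : Config n}
    (hv : Tendsto (fun k => cellGradient Q φ f (p k)) atTop (𝓝 v)) :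
    HasFDerivAt (performance Q φ f) (pairing n v) x := by
  obtain ⟨R, hRQ, hRp, hRx⟩ := exists_norm_bound hQ hp
  obtain ⟨K, hK0, hK⟩ := exists_uniform_bound hn hf R
  choose a b hab using fun q => IsNearestPair.exists_isNearestPair hn
    (fun l => dist q (x l))
  let D : Plane → Config n := fun q => φ q • pairGrad f q x (a q) (b q)
  have hgen : ∀ᵐ q ∂(volume.restrict Q), q ∈ Q ∧ IsGenericFor q x ∧
      ∀ k, IsGenericFor q (p k) := by
    filter_upwards [ae_restrict_of_ae (ae_isGenericFor x), ae_restrict_mem hQ.measurableSet,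
      ae_restrict_of_ae (ae_all_iff.2 fun k => ae_isGenericFor (p k))] with q h1 h2 h3
    exact ⟨h2, h1, h3⟩
  have hlim : ∀ᵐ q ∂(volume.restrict Q),
      Tendsto (fun k => φ q • gradIntegrand Q f (p k) q) atTop (𝓝 (D q)) := by
    filter_upwards [hgen, hnull] with q hq hc
    exact tendsto_smul_gradIntegrand hn hf hp hinj hq.1 hq.2.1 hq.2.2 hc (hab q)
  -- The nearest pairs `a q`, `b q` are chosen with no regard to measurability; `D` is measurable as
  -- an almost everywhere limit.
  have hDm : AEStronglyMeasurable D (volume.restrict Q) :=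
    aestronglyMeasurable_of_tendsto_ae atTop
      (fun k => (cellGradient_eq_integral hn hQ hφ hf (p k)).1.aestronglyMeasurable) hlim
  have hDint : ∫ q in Q, D q = v := by
    refine tendsto_nhds_unique ?_ hv
    simp_rw [fun k => (cellGradient_eq_integral hn hQ hφ hf (p k)).2]
    refine tendsto_integral_of_dominated_convergence (fun q => ‖φ q‖ * (n * K))
      (fun k => (cellGradient_eq_integral hn hQ hφ hf (p k)).1.aestronglyMeasurable)
      (hφ.norm.mul_const _) (fun k => ?_) hlim
    filter_upwards [hgen] with q hq
    rw [norm_smul]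
    exact mul_le_mul_of_nonneg_left (norm_gradIntegrand_le Q hf (hq.2.2 k).1 hK0
      ((hK q (hRQ q hq.1) (p k) (hRp k)).2.2 (hq.2.2 k).1)) (norm_nonneg _)
  have hlip : ∀ᵐ q ∂(volume.restrict Q), ∀ y ∈ Metric.ball x 1,
      ‖minCost f q y * φ q - minCost f q x * φ q‖ ≤ K * ‖φ q‖ * ‖y - x‖ := by
    filter_upwards [hgen] with q hq y hy
    have hy' : ‖y‖ ≤ R := by
      have h1 : ‖y - x‖ < 1 := by rwa [← dist_eq_norm]
      have := norm_le_norm_add_norm_sub x y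
      rw [norm_sub_rev] at this
      linarith
    have h2 := (hK q (hRQ q hq.1) y hy').1 x (by linarith)
    rw [← sub_mul, norm_mul, Real.norm_eq_abs]
    calc _ ≤ K * ‖y - x‖ * ‖φ q‖ := mul_le_mul_of_nonneg_right h2 (norm_nonneg _)
      _ = _ := by ring
  have hmain := hasFDerivAt_integral_of_dominated_loc_of_lip'
    (μ := volume.restrict Q) (F := fun (y : Config n) q => minCost f q y * φ q)
    (F' := fun q => pairing n (D q)) (bound := fun q => K * ‖φ q‖)
    (Metric.ball_mem_nhds x one_pos)
    (fun y _ => (integrable_minCost_mul hn hQ hφ hf y).aestronglyMeasurable)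
    (integrable_minCost_mul hn hQ hφ hf x)
    ((pairing n).continuous.comp_aestronglyMeasurable hDm) hlip (hφ.norm.const_mul K)
    (by
      filter_upwards [hgen, hnull] with q hq hc
      exact hasFDerivAt_minCost hn hf hq.2.1 hc (hab q))
  have hDi : Integrable D (volume.restrict Q) := by
    refine Integrable.mono' (hφ.norm.mul_const (n * K)) hDm ?_
    filter_upwards [hgen, hlim] with q hq hl
    refine le_of_tendsto hl.norm (Eventually.of_forall fun k => ?_)
    rw [norm_smul]
    exact mul_le_mul_of_nonneg_left (norm_gradIntegrand_le Q hf (hq.2.2 k).1 hK0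
      ((hK q (hRQ q hq.1) (p k) (hRp k)).2.2 (hq.2.2 k).1)) (norm_nonneg _)
  rw [ContinuousLinearMap.integral_comp_comm _ hDi, hDint] at hmain
  exact hmain.2

/-- A constant sequence suffices, as nothing can be exchanged when positions are distinct. -/
lemma hasFDerivAt_performance {n : ℕ} (hn : 2 ≤ n) {Q : Set Plane} (hQ : IsCompact Q)
    {φ : Plane → ℝ} (hφ : IntegrableOn φ Q) {f : ℝ → ℝ → ℝ} (hf : IsSensingCost f)
    {x : Config n} (hx : Function.Injective x) :
    HasFDerivAt (performance Q φ f) (pairing n (cellGradient Q φ f x)) x :=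
  hasFDerivAt_performance_of_tendsto hn hQ hφ hf (p := fun _ => x) tendsto_const_nhds
    (fun _ => hx) (Eventually.of_forall fun q => IsExchangeNull.of_injective f _ q hx)
    tendsto_const_nhds

/-! ### Moving colliding agents apart -/

lemma pairing_single_right {n : ℕ} (v : Config n) (i : Fin n) (u : Plane) :
    pairing n v (Pi.single i u) = inner ℝ (v i) u := by
  rw [pairing_apply, Finset.sum_eq_single i]
  · simp
  · intro k _ hk
    simp [hk]
  · simp

/-- The unit vector pointing from agent `j` to agent `i`. -/
noncomputable def agentDir {n : ℕ} (p : Config n) (i j : Fin n) : Plane :=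
  ‖p i - p j‖⁻¹ • (p i - p j)

lemma agentDir_swap {n : ℕ} (p : Config n) (i j : Fin n) : agentDir p j i = -agentDir p i j := by
  rw [agentDir, agentDir, norm_sub_rev, ← smul_neg, neg_sub]

lemma norm_agentDir_le {n : ℕ} (p : Config n) (i j : Fin n) : ‖agentDir p i j‖ ≤ 1 := by
  rw [agentDir, norm_smul, norm_inv, norm_norm]
  exact inv_mul_le_one

lemma norm_agentDir {n : ℕ} {p : Config n} {i j : Fin n} (h : p i ≠ p j) :
    ‖agentDir p i j‖ = 1 := by
  rw [agentDir, norm_smul, norm_inv, norm_norm]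
  exact inv_mul_cancel₀ (norm_ne_zero_iff.2 (sub_ne_zero.2 h))

/-- The direction that moves agents `i` and `j` apart. -/
noncomputable def separation {n : ℕ} (p : Config n) (i j : Fin n) : Config n :=
  Pi.single i (agentDir p i j) + Pi.single j (agentDir p j i)

lemma separation_swap {n : ℕ} (p : Config n) (i j : Fin n) :
    separation p i j = separation p j i := add_comm _ _

lemma norm_separation_le {n : ℕ} (p : Config n) (i j : Fin n) : ‖separation p i j‖ ≤ 2 := by
  refine (norm_add_le _ _).trans ?_
  rw [Pi.norm_single, Pi.norm_single]
  linarith [norm_agentDir_le p i j, norm_agentDir_le p j i]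

lemma pairing_separation {n : ℕ} (v p : Config n) (i j : Fin n) :
    pairing n v (separation p i j) =
      inner ℝ (v i) (agentDir p i j) + inner ℝ (v j) (agentDir p j i) := by
  rw [separation, map_add, pairing_single_right, pairing_single_right]

/-- The effect of a separation depends on whether both, one or none of the separated agents belong
to the nearest pair: the cases of this lemma and the next two. -/
lemma pairing_pairGrad_separation_both {n : ℕ} (f : ℝ → ℝ → ℝ) (c : ℝ) (q : Plane)
    (p : Config n) {s u : Fin n} (h : s ≠ u) :
    pairing n (c • pairGrad f q p s u) (separation p s u) =
      c * pd f (dist q (p s)) (dist q (p u)) * inner ℝ (unitTo q (p s)) (agentDir p s u) +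
      c * pd f (dist q (p u)) (dist q (p s)) * inner ℝ (unitTo q (p u)) (agentDir p u s) := by
  rw [pairing_separation, Pi.smul_apply, Pi.smul_apply, pairGrad_apply_fst _ _ _ h,
    pairGrad_swap, pairGrad_apply_fst _ _ _ h.symm]
  simp only [real_inner_smul_left]
  ring

lemma pairing_pairGrad_separation_one {n : ℕ} (f : ℝ → ℝ → ℝ) (c : ℝ) (q : Plane)
    (p : Config n) {s t u : Fin n} (hst : s ≠ t) (hus : u ≠ s) (hut : u ≠ t) :
    pairing n (c • pairGrad f q p s t) (separation p s u) =
      c * pd f (dist q (p s)) (dist q (p t)) * inner ℝ (unitTo q (p s)) (agentDir p s u) := by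
  rw [pairing_separation, Pi.smul_apply, Pi.smul_apply, pairGrad_apply_fst _ _ _ hst,
    pairGrad_apply_of_ne _ _ _ hus hut]
  simp only [real_inner_smul_left, smul_zero, inner_zero_left]
  ring

lemma pairing_pairGrad_separation_none {n : ℕ} (f : ℝ → ℝ → ℝ) (c : ℝ) (q : Plane)
    (p : Config n) {a b s u : Fin n} (hsa : s ≠ a) (hsb : s ≠ b) (hua : u ≠ a) (hub : u ≠ b) :
    pairing n (c • pairGrad f q p a b) (separation p s u) = 0 := by
  rw [pairing_separation, Pi.smul_apply, Pi.smul_apply, pairGrad_apply_of_ne _ _ _ hsa hsb,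
    pairGrad_apply_of_ne _ _ _ hua hub]
  simp

lemma limitDir_swap {n : ℕ} {p : ℕ → Config n} {E : Fin n → Fin n → Plane}
    (hE : ∀ i j, Tendsto (fun k => agentDir (p k) i j) atTop (𝓝 (E i j))) (i j : Fin n) : E j i = -E i j := by
  refine tendsto_nhds_unique (hE j i) ?_
  simp_rw [agentDir_swap _ i j]
  exact (hE i j).neg

section Limit

variable {n : ℕ} {x : Config n} {p : ℕ → Config n} (hp : Tendsto p atTop (𝓝 x))
  {E : Fin n → Fin n → Plane}
  (hE : ∀ i j, Tendsto (fun k => agentDir (p k) i j) atTop (𝓝 (E i j)))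

include hp hE

lemma tendsto_pd_mul_inner {f : ℝ → ℝ → ℝ} (hf : IsSensingCost f) (c : ℝ) {q : Plane}
    (s t u : Fin n) (hs : q ≠ x s) (ht : q ≠ x t) :
    Tendsto (fun k => c * pd f (dist q (p k s)) (dist q (p k t)) *
        inner ℝ (unitTo q (p k s)) (agentDir (p k) s u)) atTop
      (𝓝 (c * pd f (dist q (x s)) (dist q (x t)) * inner ℝ (unitTo q (x s)) (E s u))) := by
  have h1 : ∀ i, Tendsto (fun k => p k i) atTop (𝓝 (x i)) := tendsto_pi_nhds.1 hp
  have h2 : Tendsto (fun k => unitTo q (p k s)) atTop (𝓝 (unitTo q (x s))) :=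
    Tendsto.comp (g := fun z : Plane × Plane => unitTo z.1 z.2) (f := fun k => (q, p k s))
      (continuousAt_unitTo hs) (tendsto_const_nhds.prodMk_nhds (h1 s))
  have h3 : Tendsto (fun k => pd f (dist q (p k s)) (dist q (p k t))) atTop
      (𝓝 (pd f (dist q (x s)) (dist q (x t)))) :=
    Tendsto.comp (g := fun z : ℝ × ℝ => pd f z.1 z.2)
      (f := fun k => (dist q (p k s), dist q (p k t)))
      (hf.continuousAt_pd (dist_pos.2 hs) (dist_pos.2 ht)) ((tendsto_const_nhds.dist (h1 s)).prodMk_nhds (tendsto_const_nhds.dist (h1 t)))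
  exact (h3.const_mul c).mul (h2.inner (hE s u))

/-- The difference of squared distances, divided by `‖p k s - p k u‖`, tends to `2⟨E s u, x s - q⟩`.
Its sign tells which of two colliding agents is eventually closer to `q`. -/
lemma eventually_dist_lt {q : Plane} {s u : Fin n} (hsu : x u = x s)
    (h : 0 < inner ℝ (E s u) (x s - q)) :
    ∀ᶠ k in atTop, dist q (p k u) < dist q (p k s) := by
  have h1 : ∀ i, Tendsto (fun k => p k i) atTop (𝓝 (x i)) := tendsto_pi_nhds.1 hp
  have h2 : Tendsto (fun k => inner ℝ (agentDir (p k) s u) (p k s + p k u - (2 : ℝ) • q)) atTop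
      (𝓝 (inner ℝ (E s u) (x s + x u - (2 : ℝ) • q))) :=
    (hE s u).inner (((h1 s).add (h1 u)).sub_const _)
  have h3 : (0 : ℝ) < inner ℝ (E s u) (x s + x u - (2 : ℝ) • q) := by
    rw [hsu, ← two_smul ℝ (x s), ← smul_sub, real_inner_smul_right]
    linarith
  filter_upwards [h2.eventually_const_lt h3] with k hk
  rw [agentDir, real_inner_smul_left, ← dist_sq_sub_dist_sq] at hk
  have h4 := pos_of_mul_pos_right hk (inv_nonneg.2 (norm_nonneg _))
  exact lt_of_pow_lt_pow_left₀ 2 dist_nonneg (by linarith)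

/-- If both agents are in the nearest pair, their terms cancel in the limit because `E u s = -E s
u`. If only `s` is, then `s` is no farther from `q` than `u`, so `⟨E s u, x s - q⟩` is not positive,
and `0 ≤ pd` gives a nonpositive limit. If neither is, the pairing is zero. -/
lemma eventually_pairing_separation_le {f : ℝ → ℝ → ℝ} (hn : 2 ≤ n) (hf : IsSensingCost f)
    {Q : Set Plane} (hinj : ∀ k, Function.Injective (p k)) {c : ℝ} (hc : 0 ≤ c) {q : Plane}
    (hq : q ∈ Q) (hg : IsGenericFor q x) (hgp : ∀ k, IsGenericFor q (p k)) {s u : Fin n}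
    (hsu : s ≠ u) (hx : x u = x s) (hE0 : inner ℝ (E s u) (x s - q) ≠ 0) {ε : ℝ} (hε : 0 < ε) :
    ∀ᶠ k in atTop, pairing n (c • gradIntegrand Q f (p k) q) (separation (p k) s u) ≤ ε := by
  have hone : ∀ s t u, u ≠ s → u ≠ t → x u = x s → inner ℝ (E s u) (x s - q) ≠ 0 →
      ∀ᶠ k in atTop, IsNearestPair (fun l => dist q (p k l)) s t →
        pairing n (c • pairGrad f q (p k) s t) (separation (p k) s u) ≤ ε := by
    intro s t u hus hut hx hE0
    rcases lt_or_gt_of_ne hE0 with h | h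
    · have h1 : c * pd f (dist q (x s)) (dist q (x t)) * inner ℝ (unitTo q (x s)) (E s u) < ε := by
        refine lt_of_le_of_lt ?_ hε
        refine mul_nonpos_of_nonneg_of_nonpos (mul_nonneg hc
          (hf.pd_nonneg (dist_pos.2 (hg.1 s)) (dist_pos.2 (hg.1 t)))) ?_
        rw [unitTo, real_inner_smul_left, real_inner_comm]
        exact mul_nonpos_of_nonneg_of_nonpos (inv_nonneg.2 dist_nonneg) h.le
      filter_upwards [(tendsto_pd_mul_inner hp hE hf c s t u (hg.1 s)
        (hg.1 t)).eventually_lt_const h1] with k hk hnear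
      rw [pairing_pairGrad_separation_one _ _ _ _ hnear.1 hus hut]
      exact hk.le
    · filter_upwards [eventually_dist_lt hp hE hx h] with k hk hnear
      exact absurd (hnear.2 u hus hut).1 (not_le.2 hk)
  have hswap : inner ℝ (E u s) (x u - q) ≠ 0 := by
    rw [limitDir_swap hE s u, hx, inner_neg_left]
    exact neg_ne_zero.2 hE0
  have hboth : ∀ᶠ k in atTop,
      pairing n (c • pairGrad f q (p k) s u) (separation (p k) s u) ≤ ε := by
    have h1 := (tendsto_pd_mul_inner hp hE hf c s u u (hg.1 s) (hg.1 u)).add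
      (tendsto_pd_mul_inner hp hE hf c u s s (hg.1 u) (hg.1 s))
    have h2 : c * pd f (dist q (x s)) (dist q (x u)) * inner ℝ (unitTo q (x s)) (E s u) +
        c * pd f (dist q (x u)) (dist q (x s)) * inner ℝ (unitTo q (x u)) (E u s) < ε := by
      rw [hx, limitDir_swap hE s u, inner_neg_right]
      linarith
    filter_upwards [h1.eventually_lt_const h2] with k hk
    rw [pairing_pairGrad_separation_both _ _ _ _ hsu]
    exact hk.le
  have hall : ∀ a b, ∀ᶠ k in atTop, IsNearestPair (fun l => dist q (p k l)) a b →
      pairing n (c • pairGrad f q (p k) a b) (separation (p k) s u) ≤ ε := by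
    intro a b
    by_cases hsa : s = a
    · subst hsa
      by_cases hub : u = b
      · subst hub
        filter_upwards [hboth] with k hk _ using hk
      · exact hone s b u hsu.symm hub hx hE0
    by_cases hsb : s = b
    · subst hsb
      by_cases hua : u = a
      · subst hua
        filter_upwards [hboth] with k hk _
        rwa [pairGrad_swap]
      · filter_upwards [hone s a u hsu.symm hua hx hE0] with k hk hnear
        rw [pairGrad_swap]
        exact hk hnear.swap
    by_cases hua : u = a
    · subst hua
      filter_upwards [hone u b s hsu hsb hx.symm hswap] with k hk hnear
      rw [separation_swap]
      exact hk hnear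
    by_cases hub : u = b
    · subst hub
      filter_upwards [hone u a s hsu hsa hx.symm hswap] with k hk hnear
      rw [separation_swap, pairGrad_swap]
      exact hk hnear.swap
    refine Eventually.of_forall fun k _ => ?_
    rw [pairing_pairGrad_separation_none _ _ _ _ hsa hsb hua hub]
    exact hε.le
  filter_upwards [eventually_all.2 fun a => eventually_all.2 (hall a)] with k hk
  obtain ⟨a, b, hab⟩ := IsNearestPair.exists_isNearestPair hn (fun l => dist q (p k l))
  rw [gradIntegrand_eq_pairGrad hf hq (hgp k) (hinj k) hab]
  exact hk a b hab

/-- Along a recurring nearest pair with a tie, the pairing reduces to one term with limit `c * pd *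
⟨unitTo, E⟩`. This limit is zero while the inner product is not, so `c * pd` vanishes; the pair `i,
j` has the same two distances. -/
lemma isExchangeNull_of_tendsto {f : ℝ → ℝ → ℝ} (hn : 2 ≤ n) (hf : IsSensingCost f)
    {Q : Set Plane} (hinj : ∀ k, Function.Injective (p k)) {c : ℝ} {q : Plane}
    (hq : q ∈ Q) (hg : IsGenericFor q x) (hgp : ∀ k, IsGenericFor q (p k))
    (hE0 : ∀ s u, s ≠ u → inner ℝ (E s u) (x s - q) ≠ 0)
    (hlim : ∀ s u, s ≠ u → x u = x s → Tendsto (fun k =>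
      pairing n (c • gradIntegrand Q f (p k) q) (separation (p k) s u)) atTop (𝓝 0)) :
    IsExchangeNull f c q x := by
  intro i j l hij hli hlj hx
  -- Pigeonhole: there are finitely many pairs.
  obtain ⟨a, b, hab⟩ : ∃ a b, ∃ᶠ k in atTop, IsNearestPair (fun l => dist q (p k l)) a b := by
    by_contra hcon
    push Not at hcon
    have h1 := eventually_all.2 fun a => eventually_all.2 (hcon a)
    obtain ⟨k, hk⟩ := h1.exists
    obtain ⟨a, b, hab⟩ := IsNearestPair.exists_isNearestPair hn (fun l => dist q (p k l))
    exact hk a b hab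
  have habx : IsNearestPair (fun l => dist q (x l)) a b := by
    obtain ⟨k, hk1, hk2⟩ := (hab.and_eventually
      (hp.eventually (eventually_isNearestPair_imp q x))).exists
    exact hk2 a b hk1
  obtain ⟨s, t, u, hst, hus, hut, hdu, hds⟩ := habx.exists_separated hij hli hlj (by simp [hx])
  have hnear : ∃ᶠ k in atTop, IsNearestPair (fun l => dist q (p k l)) s t := by
    rcases hst with ⟨rfl, rfl⟩ | ⟨rfl, rfl⟩
    · exact hab
    · exact hab.mono fun k hk => hk.swap
  have hnearx : IsNearestPair (fun l => dist q (x l)) s t := by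
    rcases hst with ⟨rfl, rfl⟩ | ⟨rfl, rfl⟩
    · exact habx
    · exact habx.swap
  have hxu : x u = x s := by
    by_contra h
    exact hg.2 _ _ h hdu
  have h1 := (tendsto_pd_mul_inner hp hE hf c s t u (hg.1 s) (hg.1 t)).sub
    (hlim s u hus.symm hxu)
  rw [sub_zero] at h1
  have h2 : c * pd f (dist q (x s)) (dist q (x t)) * inner ℝ (unitTo q (x s)) (E s u) = 0 := by
    by_contra h
    obtain ⟨k, hk1, hk2⟩ := (hnear.and_eventually (h1.eventually_ne h)).exists
    apply hk2
    rw [gradIntegrand_eq_pairGrad hf hq (hgp k) (hinj k) hk1,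
      pairing_pairGrad_separation_one _ _ _ _ hk1.1 hus hut, sub_self]
  have h3 : inner ℝ (unitTo q (x s)) (E s u) ≠ 0 := by
    rw [unitTo, real_inner_smul_left, real_inner_comm]
    exact mul_ne_zero (inv_ne_zero (dist_ne_zero.2 (hg.1 s))) (hE0 s u hus.symm)
  have h4 : c * pd f (dist q (x s)) (dist q (x t)) = 0 := (mul_eq_zero.1 h2).resolve_right h3
  have h5 := hnearx.sum_eq hij
  have h6 : dist q (x t) = dist q (x j) := by linarith
  rwa [hds, h6] at h4

end Limit

/-- At a limit of injective configurations along which the cell gradients tend to zero,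
exchanging agents at the same position does not matter. -/
lemma ae_isExchangeNull_of_tendsto {n : ℕ} (hn : 2 ≤ n) {Q : Set Plane} (hQ : IsCompact Q)
    {φ : Plane → ℝ} (hφ : IntegrableOn φ Q) (hφ0 : ∀ q ∈ Q, 0 ≤ φ q) {f : ℝ → ℝ → ℝ}
    (hf : IsSensingCost f) {x : Config n} {p : ℕ → Config n} (hp : Tendsto p atTop (𝓝 x))
    (hinj : ∀ k, Function.Injective (p k))
    (hv : Tendsto (fun k => cellGradient Q φ f (p k)) atTop (𝓝 0)) :
    ∀ᵐ q ∂(volume.restrict Q), IsExchangeNull f (φ q) q x := by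
  -- The directions between agents stay in a compact set, so along a subsequence all of them
  -- converge, even for agents that collide.
  obtain ⟨E, -, τ, hτ, hE⟩ := (isCompact_univ_pi fun _ : Fin n => isCompact_univ_pi
    fun _ : Fin n => isCompact_closedBall (0 : Plane) 1).tendsto_subseq
    (x := fun k i j => agentDir (p k) i j)
    (fun k => by simpa [mem_univ_pi] using fun i j => norm_agentDir_le (p k) i j)
  replace hE : ∀ i j, Tendsto (fun k => agentDir ((p ∘ τ) k) i j) atTop (𝓝 (E i j)) :=
    fun i j => tendsto_pi_nhds.1 (tendsto_pi_nhds.1 hE i) j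
  replace hp := hp.comp hτ.tendsto_atTop
  replace hv := hv.comp hτ.tendsto_atTop
  replace hinj : ∀ k, Function.Injective ((p ∘ τ) k) := fun k => hinj _
  change Tendsto (fun k => cellGradient Q φ f ((p ∘ τ) k)) atTop (𝓝 0) at hv
  generalize p ∘ τ = p at hE hp hv hinj
  clear τ hτ
  -- Limits of unit vectors are unit vectors, so each condition `⟨E s u, x s - q⟩ = 0` below cuts
  -- out a line, which is null.
  have hE1 : ∀ s u, s ≠ u → E s u ≠ 0 := by
    intro s u hsu h0
    have h1 : Tendsto (fun k => ‖agentDir (p k) s u‖) atTop (𝓝 ‖E s u‖) := (hE s u).norm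
    simp_rw [fun k => norm_agentDir ((hinj k).ne hsu)] at h1
    have := tendsto_nhds_unique h1 tendsto_const_nhds
    rw [h0, norm_zero] at this
    exact zero_ne_one this
  obtain ⟨R, hRQ, hRp, -⟩ := exists_norm_bound hQ hp
  obtain ⟨K, hK0, hK⟩ := exists_uniform_bound hn hf R
  have hgen : ∀ᵐ q ∂(volume.restrict Q), q ∈ Q ∧ IsGenericFor q x ∧
      (∀ k, IsGenericFor q (p k)) ∧ ∀ s u, s ≠ u → inner ℝ (E s u) (x s - q) ≠ 0 := by
    have hne : ∀ᵐ q : Plane, ∀ s u, s ≠ u → inner ℝ (E s u) (x s - q) ≠ 0 := by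
      rw [ae_all_iff]
      intro s
      rw [ae_all_iff]
      intro u
      by_cases hsu : s = u
      · exact Eventually.of_forall fun q h => absurd hsu h
      · filter_upwards [measure_eq_zero_iff_ae_notMem.1 (volume_setOf_inner_eq (hE1 s u hsu)
          (inner ℝ (E s u) (x s)))] with q hq _ h0
        rw [inner_sub_right, sub_eq_zero] at h0
        exact hq h0.symm
    filter_upwards [ae_restrict_of_ae (ae_isGenericFor x), ae_restrict_mem hQ.measurableSet,
      ae_restrict_of_ae (ae_all_iff.2 fun k => ae_isGenericFor (p k)),
      ae_restrict_of_ae hne] with q h1 h2 h3 h4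
    exact ⟨h2, h1, h3, h4⟩
  classical
  -- Only pairs of agents that collide at `x` are tested.
  let ι := {c : Fin n × Fin n // c.1 ≠ c.2 ∧ x c.2 = x c.1}
  let Φ : ι → ℕ → Plane → ℝ := fun c k q =>
    pairing n (φ q • gradIntegrand Q f (p k) q) (separation (p k) c.1.1 c.1.2)
  have hcell := fun k => cellGradient_eq_integral hn hQ hφ hf (p k)
  have hΦ : ∀ c k, Φ c k = fun q => (pairing n).flip (separation (p k) c.1.1 c.1.2)
      (φ q • gradIntegrand Q f (p k) q) := fun c k => rfl
  obtain ⟨σ, hσ, hlim⟩ := exists_subseq_tendsto_zero_of_integral (μ := volume.restrict Q)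
    (Φ := Φ) (B := fun q => ‖pairing n‖ * (‖φ q‖ * (n * K)) * 2)
    (((hφ.norm.mul_const _).const_mul _).mul_const _)
    (fun c k => by
      rw [hΦ]
      exact ((pairing n).flip _).continuous.comp_aestronglyMeasurable
        (hcell k).1.aestronglyMeasurable)
    (fun c k => by
      filter_upwards [hgen] with q hq
      refine ((pairing n).le_opNorm₂ _ _).trans ?_
      have h1 : ‖φ q • gradIntegrand Q f (p k) q‖ ≤ ‖φ q‖ * (n * K) := by
        rw [norm_smul]
        exact mul_le_mul_of_nonneg_left (norm_gradIntegrand_le Q hf (hq.2.2.1 k).1 hK0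
          ((hK q (hRQ q hq.1) (p k) (hRp k)).2.2 (hq.2.2.1 k).1)) (norm_nonneg _)
      have h2 := norm_separation_le (p k) c.1.1 c.1.2
      gcongr)
    (by
      filter_upwards [hgen] with q hq c ε hε
      exact eventually_pairing_separation_le hp hE hn hf hinj (hφ0 q hq.1) hq.1 hq.2.1 hq.2.2.1
        c.2.1 c.2.2 (hq.2.2.2 _ _ c.2.1) hε)
    (fun c => by
      have e : ∀ k, ∫ q in Q, Φ c k q =
          pairing n (cellGradient Q φ f (p k)) (separation (p k) c.1.1 c.1.2) := by
        intro k
        rw [hΦ, ContinuousLinearMap.integral_comp_comm _ (hcell k).1, ← (hcell k).2]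
        rfl
      simp_rw [e]
      refine squeeze_zero_norm (fun k => (pairing n).le_opNorm₂ _ _) ?_
      have h1 : Tendsto (fun k => ‖pairing n‖ * ‖cellGradient Q φ f (p k)‖ * 2) atTop (𝓝 0) := by
        simpa using (hv.norm.const_mul ‖pairing n‖).mul_const 2
      refine squeeze_zero (fun k => by positivity) (fun k => ?_) h1
      have h2 := norm_separation_le (p k) c.1.1 c.1.2
      gcongr)
  filter_upwards [hgen, hlim] with q hq hl
  exact isExchangeNull_of_tendsto (hp.comp hσ.tendsto_atTop)
    (fun i j => (hE i j).comp hσ.tendsto_atTop) hn hf (fun k => hinj _) hq.1 hq.2.1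
    (fun k => hq.2.2.1 _) hq.2.2.2 (fun s u hsu hx => hl ⟨(s, u), hsu, hx⟩)

/-- A limit of injective configurations along which the cell gradients tend to zero is a critical
point of the performance function. -/
lemma mem_criticalPoints_of_tendsto {n : ℕ} (hn : 2 ≤ n) {Q : Set Plane} (hQ : IsCompact Q)
    {φ : Plane → ℝ} (hφ : IntegrableOn φ Q) (hφ0 : ∀ q ∈ Q, 0 ≤ φ q) {f : ℝ → ℝ → ℝ}
    (hf : IsSensingCost f) {x : Config n} {p : ℕ → Config n} (hp : Tendsto p atTop (𝓝 x))
    (hinj : ∀ k, Function.Injective (p k))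
    (hv : Tendsto (fun k => cellGradient Q φ f (p k)) atTop (𝓝 0)) :
    x ∈ criticalPoints (performance Q φ f) := by
  have := hasFDerivAt_performance_of_tendsto hn hQ hφ hf hp hinj
    (ae_isExchangeNull_of_tendsto hn hQ hφ hφ0 hf hp hinj hv) hv
  rwa [map_zero] at this

/-! ### Descent along curves and cluster points -/

/-- The barrier `M + η (1 + (s - a))` stays above `M` and has slope `η > 0`, whereas `y' ≤ 0`
wherever `y` meets it. The choice of `η` makes the barrier equal `M + ε` at time `t`. -/
lemma le_of_deriv_right_nonpos_above {y y' : ℝ → ℝ} {a b M : ℝ} (hc : ContinuousOn y (Icc a b))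
    (hy : ∀ t ∈ Ico a b, HasDerivWithinAt y (y' t) (Ici t) t) (ha : y a ≤ M)
    (h : ∀ t ∈ Ico a b, M < y t → y' t ≤ 0) {t : ℝ} (ht : t ∈ Icc a b) : y t ≤ M := by
  apply le_of_forall_pos_le_add
  intro ε hε
  have hpos : 0 < 1 + (t - a) := by linarith [ht.1]
  let η := ε / (1 + (t - a))
  have hη : 0 < η := div_pos hε hpos
  have h1 := image_le_of_deriv_right_lt_deriv_boundary hc hy
    (B := fun s => M + η * (1 + (s - a))) (B' := fun _ => η) (by simp; linarith)
    (fun s => by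
      have := ((((hasDerivAt_id s).sub_const a).const_add 1).const_mul η).const_add M
      simpa using this)
    (fun s hs hys => by
      refine (h s hs ?_).trans_lt hη
      rw [hys]
      have : 0 < η * (1 + (s - a)) := mul_pos hη (by linarith [hs.1])
      linarith) ht
  have h2 : η * (1 + (t - a)) = ε := div_mul_cancel₀ _ hpos.ne'
  simp only [h2] at h1
  exact h1

/-- Being antitone and bounded below, `h` eventually drops by less than `κ * δ * ε ^ 2`; the mean
value theorem then gives a time in the interval with `|g| < ε`. Since `g` is not assumed continuous,
nothing is claimed about the other times. -/
lemma exists_small_of_deriv_le {h h' g : ℝ → ℝ} {κ C : ℝ} (hκ : 0 < κ)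
    (hd : ∀ t, 0 ≤ t → HasDerivWithinAt h (h' t) (Ici 0) t)
    (hle : ∀ t, 0 ≤ t → h' t ≤ -κ * g t ^ 2) (hC : ∀ t, 0 ≤ t → C ≤ h t)
    {δ ε : ℝ} (hδ : 0 < δ) (hε : 0 < ε) :
    ∀ᶠ t in atTop, ∃ s ∈ Ioo t (t + δ), |g s| < ε := by
  have hcont : ContinuousOn h (Ici 0) := fun t ht => (hd t ht).continuousWithinAt
  have hat : ∀ t, 0 < t → HasDerivAt h (h' t) t := fun t ht =>
    (hd t ht.le).hasDerivAt (Ici_mem_nhds ht)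
  have hanti : AntitoneOn h (Ici 0) := by
    apply antitoneOn_of_deriv_nonpos (convex_Ici 0) hcont
    · rw [interior_Ici]
      exact fun t ht => (hat t ht).differentiableAt.differentiableWithinAt
    · rw [interior_Ici]
      intro t ht
      rw [(hat t ht).deriv]
      have := hle t (le_of_lt ht)
      nlinarith [sq_nonneg (g t)]
  have hbdd : BddBelow (h '' Ici 0) := ⟨C, by rintro _ ⟨t, ht, rfl⟩; exact hC t ht⟩
  obtain ⟨_, ⟨t₀, ht₀, rfl⟩, hlt⟩ := exists_lt_of_csInf_lt
    (⟨h 0, 0, self_mem_Ici, rfl⟩ : (h '' Ici 0).Nonempty)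
    (lt_add_of_pos_right (sInf (h '' Ici 0)) (show 0 < κ * δ * ε ^ 2 by positivity))
  filter_upwards [eventually_ge_atTop t₀] with t ht
  have ht0 : 0 ≤ t := le_trans ht₀ ht
  obtain ⟨s, hs, hs'⟩ := exists_hasDerivAt_eq_slope h h' (show t < t + δ by linarith)
    (hcont.mono fun s hs => ht0.trans hs.1) (fun s hs => hat s (ht0.trans_lt hs.1))
  refine ⟨s, hs, ?_⟩
  have h1 : h t ≤ h t₀ := hanti ht₀ ht0 ht
  have h2 : sInf (h '' Ici 0) ≤ h (t + δ) := csInf_le hbdd ⟨t + δ, by simp; linarith, rfl⟩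
  have h3 := hle s (ht0.trans hs.1.le)
  rw [hs', add_sub_cancel_left, div_le_iff₀ hδ] at h3
  have h4 : κ * δ * g s ^ 2 < κ * δ * ε ^ 2 := by nlinarith
  exact abs_lt_of_sq_lt_sq (lt_of_mul_lt_mul_left h4 (by positivity)) hε.le

/-- A cluster point of a Lipschitz curve is the limit of a sequence of points of the curve along
which `g` tends to zero, if `g` is small somewhere in each late time interval of given length. -/
lemma exists_seq_of_mapClusterPt {X : Type*} [PseudoMetricSpace X] {p : ℝ → X} {g : ℝ → ℝ} {V : ℝ}
    (hV : ∀ s t, 0 ≤ s → 0 ≤ t → dist (p s) (p t) ≤ V * |s - t|)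
    (hg : ∀ δ ε : ℝ, 0 < δ → 0 < ε → ∀ᶠ t in atTop, ∃ s ∈ Ioo t (t + δ), |g s| < ε)
    {x : X} (hx : MapClusterPt x atTop p) :
    ∃ s : ℕ → ℝ, (∀ m, 0 ≤ s m) ∧ Tendsto (fun m => p (s m)) atTop (𝓝 x) ∧
      Tendsto (fun m => g (s m)) atTop (𝓝 0) := by
  -- The same number `1 / (m + 1)` is the distance of `p t` from `x`, the length of the time
  -- interval and the bound on `g`; hence the factor `|V| + 1`.
  have h1 : ∀ m : ℕ, ∃ s, 0 ≤ s ∧ dist (p s) x ≤ (|V| + 1) * (1 / ((m : ℝ) + 1)) ∧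
      |g s| ≤ 1 / ((m : ℝ) + 1) := by
    intro m
    have hm : 0 < 1 / ((m : ℝ) + 1) := Nat.one_div_pos_of_nat
    obtain ⟨t, ht, ht0, s, hs, hgs⟩ :=
      ((mapClusterPt_iff_frequently.1 hx _ (Metric.ball_mem_nhds x hm)).and_eventually
        ((eventually_ge_atTop 0).and (hg _ _ hm hm))).exists
    have hs0 : 0 ≤ s := ht0.trans hs.1.le
    refine ⟨s, hs0, ?_, hgs.le⟩
    have h2 : |s - t| ≤ 1 / ((m : ℝ) + 1) := by
      rw [abs_of_nonneg (by linarith [hs.1])]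
      linarith [hs.2]
    have h3 : dist (p s) (p t) ≤ |V| * (1 / ((m : ℝ) + 1)) :=
      (hV s t hs0 ht0).trans (mul_le_mul (le_abs_self V) h2 (abs_nonneg _) (abs_nonneg _))
    have h4 := dist_triangle (p s) (p t) x
    rw [Metric.mem_ball] at ht
    linarith
  choose s hs0 hs1 hs2 using h1
  refine ⟨s, hs0, ?_, ?_⟩
  · rw [tendsto_iff_dist_tendsto_zero]
    refine squeeze_zero (fun m => dist_nonneg) hs1 ?_
    simpa using (tendsto_one_div_add_atTop_nhds_zero_nat (𝕜 := ℝ)).const_mul (|V| + 1)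
  · exact squeeze_zero_norm hs2 tendsto_one_div_add_atTop_nhds_zero_nat

/-- Times at which the curve stays away from `S` would, by compactness of `B`, have a cluster point,
and that point lies in `S`. Nonemptiness of `S` comes out of the same argument. -/
lemma convergesToSet_of_mapClusterPt {n : ℕ} {p : ℝ → Config n} {S B : Set (Config n)}
    (hB : IsCompact B) (hp : ∀ t, 0 ≤ t → p t ∈ B) (hS : ∀ x, MapClusterPt x atTop p → x ∈ S) :
    ConvergesToSet p S := by
  rw [ConvergesToSet, ENNReal.tendsto_nhds_zero]
  intro ε hε
  by_contra hcon
  rw [not_eventually] at hcon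
  have : (atTop ⊓ 𝓟 {t | ¬Metric.infEDist (p t) S ≤ ε}).NeBot :=
    frequently_mem_iff_neBot.1 hcon
  obtain ⟨x, -, hx⟩ := hB (f := map p (atTop ⊓ 𝓟 {t | ¬Metric.infEDist (p t) S ≤ ε})) (by
    rw [le_principal_iff, mem_map]
    filter_upwards [mem_inf_of_left (eventually_ge_atTop (0 : ℝ))] with t ht using hp t ht)
  have hxS : x ∈ S := hS x (ClusterPt.mono hx (map_mono inf_le_left))
  have h1 : Metric.eball x ε ∈ 𝓝 x := Metric.eball_mem_nhds x hε
  have h2 := mapClusterPt_iff_frequently.1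
    (show MapClusterPt x (atTop ⊓ 𝓟 {t | ¬Metric.infEDist (p t) S ≤ ε}) p from hx) _ h1
  obtain ⟨t, ht1, ht2⟩ := (h2.and_eventually (mem_inf_of_right (mem_principal_self _))).exists
  exact ht2 ((Metric.infEDist_le_edist_of_mem hxS).trans (Metric.mem_eball.1 ht1).le)

/-- `Config n` carries the sup norm, while `pairing` is the Euclidean inner product. -/
lemma sq_norm_le_pairing_self {n : ℕ} (v : Config n) : ‖v‖ ^ 2 ≤ pairing n v v := by
  rw [pairing_apply]
  have h0 : 0 ≤ ∑ k, inner ℝ (v k) (v k) := Finset.sum_nonneg fun k _ => real_inner_self_nonneg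
  have h1 : ‖v‖ ≤ √(∑ k, inner ℝ (v k) (v k)) := by
    rw [pi_norm_le_iff_of_nonneg (Real.sqrt_nonneg _)]
    intro i
    apply Real.le_sqrt_of_sq_le
    rw [← real_inner_self_eq_norm_sq]
    exact Finset.single_le_sum (f := fun k => inner ℝ (v k) (v k))
      (fun k _ => real_inner_self_nonneg) (Finset.mem_univ i)
  calc ‖v‖ ^ 2 ≤ √(∑ k, inner ℝ (v k) (v k)) ^ 2 := by gcongr
    _ = _ := Real.sq_sqrt h0

lemma exists_lower_bound_performance {n : ℕ} (hn : 2 ≤ n) {Q : Set Plane} (hQ : IsCompact Q)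
    {φ : Plane → ℝ} (hφ : IntegrableOn φ Q) {f : ℝ → ℝ → ℝ} (hf : IsSensingCost f) (R : ℝ) :
    ∃ C : ℝ, ∀ x : Config n, ‖x‖ ≤ R → C ≤ performance Q φ f x := by
  obtain ⟨R', hR'⟩ := hQ.isBounded.exists_norm_le
  obtain ⟨K, hK0, hK⟩ := exists_uniform_bound (n := n) hn hf (max R' R)
  refine ⟨-∫ q in Q, K * ‖φ q‖, fun x hx => ?_⟩
  have h1 : ‖performance Q φ f x‖ ≤ ∫ q in Q, K * ‖φ q‖ := by
    refine norm_integral_le_of_norm_le (hφ.norm.const_mul K) ?_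
    filter_upwards [ae_restrict_mem hQ.measurableSet] with q hq
    rw [norm_mul]
    exact mul_le_mul_of_nonneg_right (hK q ((hR' q hq).trans (le_max_left _ _)) x
      (hx.trans (le_max_right _ _))).2.1 (norm_nonneg _)
  exact (abs_le.1 h1).1

lemma exists_bound_cellGradient {n : ℕ} (hn : 2 ≤ n) {Q : Set Plane} (hQ : IsCompact Q)
    {φ : Plane → ℝ} (hφ : IntegrableOn φ Q) {f : ℝ → ℝ → ℝ} (hf : IsSensingCost f) (R : ℝ) :
    ∃ C : ℝ, ∀ x : Config n, ‖x‖ ≤ R → ‖cellGradient Q φ f x‖ ≤ C := by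
  obtain ⟨R', hR'⟩ := hQ.isBounded.exists_norm_le
  obtain ⟨K, hK0, hK⟩ := exists_uniform_bound (n := n) hn hf (max R' R)
  refine ⟨∫ q in Q, ‖φ q‖ * (n * K), fun x hx => ?_⟩
  rw [(cellGradient_eq_integral hn hQ hφ hf x).2]
  refine norm_integral_le_of_norm_le (hφ.norm.mul_const _) ?_
  filter_upwards [ae_restrict_mem hQ.measurableSet,
    ae_restrict_of_ae (ae_isGenericFor x)] with q hq hg
  rw [norm_smul]
  exact mul_le_mul_of_nonneg_left (norm_gradIntegrand_le Q hf hg.1 hK0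
    ((hK q ((hR' q hq).trans (le_max_left _ _)) x (hx.trans (le_max_right _ _))).2.2 hg.1))
    (norm_nonneg _)

/-- Along a bounded curve that descends the performance function at a rate controlled by the
gradient, each cluster point is a limit of points with gradient tending to zero. -/
lemma exists_seq_cellGradient_tendsto_zero {n : ℕ} (hn : 2 ≤ n) {Q : Set Plane}
    (hQ : IsCompact Q) {φ : Plane → ℝ} (hφ : IntegrableOn φ Q) {f : ℝ → ℝ → ℝ}
    (hf : IsSensingCost f) {p : ℝ → Config n} {F : ℝ → Config n}
    (hinj : ∀ t, 0 ≤ t → Function.Injective (p t))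
    (hd : ∀ t, 0 ≤ t → HasDerivWithinAt p (F t) (Ici 0) t) {R V κ : ℝ} (hκ : 0 < κ)
    (hR : ∀ t, 0 ≤ t → ‖p t‖ ≤ R) (hV : ∀ t, 0 ≤ t → ‖F t‖ ≤ V)
    (hdesc : ∀ t, 0 ≤ t →
      pairing n (cellGradient Q φ f (p t)) (F t) ≤ -κ * ‖cellGradient Q φ f (p t)‖ ^ 2)
    {x : Config n} (hx : MapClusterPt x atTop p) :
    ∃ s : ℕ → ℝ, (∀ m, 0 ≤ s m) ∧ Tendsto (fun m => p (s m)) atTop (𝓝 x) ∧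
      Tendsto (fun m => cellGradient Q φ f (p (s m))) atTop (𝓝 0) := by
  obtain ⟨C, hC⟩ := exists_lower_bound_performance (n := n) hn hQ hφ hf R
  have hlip : ∀ s t, 0 ≤ s → 0 ≤ t → dist (p s) (p t) ≤ V * |s - t| := by
    intro s t hs ht
    rw [dist_eq_norm, ← Real.norm_eq_abs]
    exact Convex.norm_image_sub_le_of_norm_hasDerivWithin_le hd hV (convex_Ici 0) ht hs
  obtain ⟨s, hs0, hs1, hs2⟩ := exists_seq_of_mapClusterPt
    (g := fun t => ‖cellGradient Q φ f (p t)‖) hlip (fun δ ε hδ hε =>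
      exists_small_of_deriv_le (h := fun t => performance Q φ f (p t)) hκ
        (fun t ht => (hasFDerivAt_performance hn hQ hφ hf (hinj t ht)).comp_hasDerivWithinAt t
          (hd t ht)) hdesc (fun t ht => hC _ (hR t ht)) hδ hε) hx
  exact ⟨s, hs0, hs1, tendsto_zero_iff_norm_tendsto_zero.2 hs2⟩

/-! ### The gradient flow -/

/-- If `‖q‖ ≤ ‖p i‖` then `⟨p i - q, p i⟩ ≥ 0`, and costs increase with distance. An agent farther
out than all of `Q` is therefore never driven outwards, which bounds the gradient flow. -/
lemma inner_cellGradient_nonneg {n : ℕ} (hn : 2 ≤ n) {Q : Set Plane} (hQ : IsCompact Q)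
    {φ : Plane → ℝ} (hφ : IntegrableOn φ Q) (hφ0 : ∀ q ∈ Q, 0 ≤ φ q) {f : ℝ → ℝ → ℝ}
    (hf : IsSensingCost f) {p : Config n} (hinj : Function.Injective p) {i : Fin n}
    (hi : ∀ q ∈ Q, ‖q‖ ≤ ‖p i‖) : 0 ≤ inner ℝ (p i) (cellGradient Q φ f p i) := by
  have hcell := cellGradient_eq_integral hn hQ hφ hf p
  rw [real_inner_comm, ← pairing_single_right, hcell.2]
  change 0 ≤ (pairing n).flip (Pi.single i (p i)) _
  rw [← ContinuousLinearMap.integral_comp_comm _ hcell.1]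
  apply integral_nonneg_of_ae
  filter_upwards [ae_restrict_mem hQ.measurableSet,
    ae_restrict_of_ae (ae_isGenericFor p)] with q hq hg
  have key : ∀ a b, a ≠ b → i = a → 0 ≤ inner ℝ (pairGrad f q p a b i) (p i) := by
    rintro a b hab rfl
    rw [pairGrad_apply_fst _ _ _ hab, real_inner_smul_left, unitTo, real_inner_smul_left,
      inner_sub_left, real_inner_self_eq_norm_sq]
    have h1 := real_inner_le_norm q (p i)
    have h2 : ‖q‖ * ‖p i‖ ≤ ‖p i‖ * ‖p i‖ :=
      mul_le_mul_of_nonneg_right (hi q hq) (norm_nonneg _)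
    exact mul_nonneg (hf.pd_nonneg (dist_pos.2 (hg.1 _)) (dist_pos.2 (hg.1 _)))
      (mul_nonneg (inv_nonneg.2 dist_nonneg) (by nlinarith))
  obtain ⟨a, b, hab⟩ := IsNearestPair.exists_isNearestPair hn (fun l => dist q (p l))
  rw [gradIntegrand_eq_pairGrad hf hq hg hinj hab]
  change 0 ≤ pairing n (φ q • pairGrad f q p a b) (Pi.single i (p i))
  rw [map_smul, _root_.smul_apply, pairing_single_right]
  refine mul_nonneg (hφ0 q hq) ?_
  by_cases h1 : i = a
  · exact key a b hab.1 h1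
  by_cases h2 : i = b
  · rw [pairGrad_swap]
    exact key b a hab.1.symm h2
  rw [pairGrad_apply_of_ne _ _ _ h1 h2, inner_zero_left]

lemma hasDerivWithinAt_Ici_of_nonneg {E : Type*} [NormedAddCommGroup E] [NormedSpace ℝ E]
    {y : ℝ → E} {y' : E} {t : ℝ} (ht : 0 ≤ t) (h : HasDerivWithinAt y y' (Ici 0) t) :
    HasDerivWithinAt y y' (Ici t) t :=
  h.mono (Ici_subset_Ici.2 ht)

lemma gradientFlow_convergesToSet {n : ℕ} (hn : 2 ≤ n) {Q : Set Plane} (hQ : IsCompact Q)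
    {φ : Plane → ℝ} (hφ : IntegrableOn φ Q) (hφ0 : ∀ q ∈ Q, 0 ≤ φ q) {f : ℝ → ℝ → ℝ}
    (hf : IsSensingCost f) {p : ℝ → Config n}
    (hp : IsClosedLoopSolution (fun x i => -cellGradient Q φ f x i) p) :
    ConvergesToSet p (criticalPoints (performance Q φ f)) := by
  obtain ⟨R₀, hR₀⟩ := hQ.isBounded.exists_norm_le
  let R := max (max R₀ 0) ‖p 0‖
  have hR0 : 0 ≤ R := le_max_of_le_left (le_max_right _ _)
  have hbdd : ∀ t, 0 ≤ t → ‖p t‖ ≤ R := by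
    intro t ht
    rw [pi_norm_le_iff_of_nonneg hR0]
    intro i
    have hd : ∀ s, 0 ≤ s → HasDerivWithinAt (fun s => ‖p s i‖ ^ 2)
        (2 * inner ℝ (p s i) (-cellGradient Q φ f (p s) i)) (Ici 0) s := fun s hs =>
      ((hp s hs).2 i).norm_sq
    -- The ball of radius `R` contains `Q` and the initial positions, and outside it the squared
    -- norm of an agent does not increase.
    have h1 := le_of_deriv_right_nonpos_above (M := R ^ 2) (a := 0) (b := t)
      (fun s hs => ((hd s hs.1).continuousWithinAt).mono Icc_subset_Ici_self)
      (fun s hs => hasDerivWithinAt_Ici_of_nonneg hs.1 (hd s hs.1))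
      (by
        have := norm_le_pi_norm (p 0) i
        have h2 : ‖p 0 i‖ ≤ R := this.trans (le_max_right _ _)
        gcongr)
      (fun s hs hlt => by
        have h2 : R < ‖p s i‖ := lt_of_pow_lt_pow_left₀ 2 (norm_nonneg _) hlt
        have h3 := inner_cellGradient_nonneg hn hQ hφ hφ0 hf (hp s hs.1).1 (i := i)
          (fun q hq => (((hR₀ q hq).trans (le_max_left _ _)).trans (le_max_left _ _)).trans h2.le)
        rw [inner_neg_right]
        linarith) (right_mem_Icc.2 ht)
    exact le_of_sq_le_sq h1 hR0
  obtain ⟨V, hV⟩ := exists_bound_cellGradient (n := n) hn hQ hφ hf R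
  refine convergesToSet_of_mapClusterPt (isCompact_closedBall (0 : Config n) R)
    (fun t ht => by simpa using hbdd t ht) fun x hx => ?_
  obtain ⟨s, hs0, hs1, hs2⟩ := exists_seq_cellGradient_tendsto_zero hn hQ hφ hf
    (F := fun t => -cellGradient Q φ f (p t)) (fun t ht => (hp t ht).1)
    (fun t ht => hasDerivWithinAt_pi.2 (hp t ht).2) one_pos hbdd
    (fun t ht => by rw [norm_neg]; exact hV _ (hbdd t ht))
    (fun t ht => by
      rw [map_neg]
      linarith [sq_norm_le_pairing_self (cellGradient Q φ f (p t))]) hx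
  exact mem_criticalPoints_of_tendsto hn hQ hφ hφ0 hf hs1 (fun k => (hp _ (hs0 k)).1) hs2

lemma hasGradientAt_performance_update {n : ℕ} (hn : 2 ≤ n) {Q : Set Plane} (hQ : IsCompact Q)
    {φ : Plane → ℝ} (hφ : IntegrableOn φ Q) {f : ℝ → ℝ → ℝ} (hf : IsSensingCost f)
    {x : Config n} (hx : Function.Injective x) (i : Fin n) :
    HasGradientAt (fun y : Plane => performance Q φ f (Function.update x i y))
      (cellGradient Q φ f x i) (x i) := by
  rw [hasGradientAt_iff_hasFDerivAt]
  have h1 : HasFDerivAt (performance Q φ f) (pairing n (cellGradient Q φ f x))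
      (Function.update x i (x i)) := by
    rw [Function.update_eq_self]
    exact hasFDerivAt_performance hn hQ hφ hf hx
  refine (h1.comp (x i) (hasFDerivAt_update x (x i))).congr_fderiv ?_
  ext w
  rw [ContinuousLinearMap.comp_apply, InnerProductSpace.toDual_apply_apply,
    ← pairing_single_right]
  congr 1
  funext k
  by_cases hk : k = i
  · subst hk
    simp
  · simp [hk]

/-! ### The quadratic cost: masses, moments and centroids -/

lemma isSensingCost_quadCost : IsSensingCost quadCost := by
  have hc : ContDiff ℝ 1 (fun z : ℝ × ℝ => quadCost z.1 z.2) := by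
    unfold quadCost
    fun_prop
  refine ⟨hc.locallyLipschitz.locallyLipschitzOn, hc.contDiffOn, fun a b ha _ => ?_,
    fun a b _ hb => ?_, fun a b _ _ => by unfold quadCost; ring⟩
  · have h1 : HasDerivAt (fun s => quadCost s b) a a := by
      have := (((hasDerivAt_id a).pow 2).add_const (b ^ 2)).const_mul (1 / 2)
      simpa [quadCost] using this
    rw [h1.deriv]
    exact ha.le
  · have h1 : HasDerivAt (fun s => quadCost a s) b b := by
      have := (((hasDerivAt_id b).pow 2).const_add (a ^ 2)).const_mul (1 / 2)
      simpa [quadCost] using this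
    rw [h1.deriv]
    exact hb.le

lemma pd_quadCost (a b : ℝ) : pd quadCost a b = a := by
  have h1 : HasDerivAt (fun s => quadCost s b) a a := by
    have := (((hasDerivAt_id a).pow 2).add_const (b ^ 2)).const_mul (1 / 2)
    simpa [quadCost] using this
  exact h1.deriv

/-- The squared distance is smooth, so unlike in `gradient_cost` the case `q = y` is included. -/
lemma gradient_quadCost (q y : Plane) (b : ℝ) :
    gradient (fun x : Plane => quadCost (dist q x) b) y = y - q := by
  apply HasGradientAt.gradient
  rw [hasGradientAt_iff_hasFDerivAt]
  have h1 : HasFDerivAt (fun x : Plane => x - q) (ContinuousLinearMap.id ℝ Plane) y :=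
    (hasFDerivAt_id y).sub_const q
  have h2 := (h1.norm_sq.add_const (b ^ 2)).const_mul (1 / 2)
  have e : (fun x : Plane => quadCost (dist q x) b) =
      fun x => 1 / 2 * (‖x - q‖ ^ 2 + b ^ 2) := by
    funext x
    rw [quadCost, dist_comm, dist_eq_norm]
  rw [e]
  refine h2.congr_fderiv ?_
  ext w
  simp

lemma sum_pairsWith {n : ℕ} {M : Type*} [AddCommMonoid M] (i : Fin n)
    (g : Finset (Fin n) → M) :
    ∑ T ∈ pairsWith i, g T = ∑ j ∈ Finset.univ.erase i, g {i, j} := by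
  symm
  refine Finset.sum_bij (fun j _ => {i, j}) ?_ ?_ ?_ (fun _ _ => rfl)
  · intro j hj
    simp only [pairsWith, Finset.mem_filter, Finset.mem_powersetCard]
    exact ⟨⟨Finset.subset_univ _, Finset.card_pair (Finset.ne_of_mem_erase hj).symm⟩, by simp⟩
  · intro j hj k hk h
    have h1 : j ∈ ({i, k} : Finset (Fin n)) := by rw [← h]; simp
    have h2 := Finset.ne_of_mem_erase hj
    simp only [Finset.mem_insert, Finset.mem_singleton] at h1
    exact h1.resolve_left h2
  · intro T hT
    simp only [pairsWith, Finset.mem_filter, Finset.mem_powersetCard] at hT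
    obtain ⟨⟨-, hc⟩, hi⟩ := hT
    obtain ⟨a, b, hab, rfl⟩ := Finset.card_eq_two.1 hc
    simp only [Finset.mem_insert, Finset.mem_singleton] at hi
    rcases hi with rfl | rfl
    · exact ⟨b, by simp [hab.symm], rfl⟩
    · exact ⟨a, by simp [hab], Finset.pair_comm _ _⟩

/-- The first moment of the order-2 cells of the pairs containing agent `i`. -/
noncomputable def momentW {n : ℕ} (Q : Set Plane) (φ : Plane → ℝ) (p : Config n) (i : Fin n) :
    Plane := ∑ T ∈ pairsWith i, ∫ q in voronoiCell Q p T, φ q • q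

/-- On a cell of zero mass the density vanishes almost everywhere, so the default value of
`massCentroid` does no harm. -/
lemma mass_smul_massCentroid {Q : Set Plane} {φ : Plane → ℝ} (hφ : IntegrableOn φ Q) 
    (hφ0 : ∀ q ∈ Q, 0 ≤ φ q) {V : Set Plane}
    (hV : MeasurableSet V) (hVQ : V ⊆ Q) :
    mass φ V • massCentroid φ V = ∫ q in V, φ q • q := by
  by_cases h : mass φ V = 0
  · have h1 : φ =ᵐ[volume.restrict V] 0 := by
      refine (setIntegral_eq_zero_iff_of_nonneg_ae ?_ (hφ.mono_set hVQ)).1 h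
      filter_upwards [ae_restrict_mem hV] with q hq using hφ0 q (hVQ hq)
    rw [h, zero_smul, integral_eq_zero_of_ae]
    filter_upwards [h1] with q hq
    simp [hq]
  · rw [massCentroid, smul_inv_smul₀ h]

lemma mass_mono {Q : Set Plane} {φ : Plane → ℝ} (hφ : IntegrableOn φ Q)
    (hφ0 : ∀ q ∈ Q, 0 ≤ φ q) {V W : Set Plane} (hW : MeasurableSet W)
    (hVW : V ⊆ W) (hWQ : W ⊆ Q) :
    mass φ V ≤ mass φ W := by
  refine setIntegral_mono_set (hφ.mono_set hWQ) ?_ (LE.le.eventuallyLE hVW)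
  filter_upwards [ae_restrict_mem hW] with q hq using hφ0 q (hWQ hq)

lemma mass_nonneg {Q : Set Plane} {φ : Plane → ℝ} (hφ0 : ∀ q ∈ Q, 0 ≤ φ q)
    {V : Set Plane} (hV : MeasurableSet V) (hVQ : V ⊆ Q) : 0 ≤ mass φ V :=
  setIntegral_nonneg hV fun q hq => hφ0 q (hVQ hq)

lemma massW_nonneg {n : ℕ} {Q : Set Plane} (hQ : IsCompact Q) {φ : Plane → ℝ}
    (hφ0 : ∀ q ∈ Q, 0 ≤ φ q) (p : Config n) (i : Fin n) : 0 ≤ massW Q φ p i :=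
  Finset.sum_nonneg fun T _ => mass_nonneg hφ0
    (isClosed_voronoiCell hQ.isClosed p T).measurableSet (voronoiCell_subset p T)

section Mass

variable {n : ℕ} {Q : Set Plane} (hQ : IsCompact Q) {φ : Plane → ℝ} (hφ : IntegrableOn φ Q)

include hQ hφ

lemma integrableOn_smul_self : IntegrableOn (fun q => φ q • q) Q := by
  obtain ⟨R, hR⟩ := hQ.isBounded.exists_norm_le
  refine integrable_smul_of_ae_bound (C := R) hφ continuous_id.aestronglyMeasurable ?_
  filter_upwards [ae_restrict_mem hQ.measurableSet] with q hq using hR q hq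

lemma cellGradient_quadCost (p : Config n) (i : Fin n) :
    cellGradient Q φ quadCost p i = massW Q φ p i • p i - momentW Q φ p i := by
  rw [cellGradient, massW, momentW, sum_pairsWith, sum_pairsWith, Finset.sum_smul,
    ← Finset.sum_sub_distrib]
  refine Finset.sum_congr rfl fun j _ => ?_
  simp_rw [gradient_quadCost, smul_sub]
  have h1 : IntegrableOn φ (voronoiCell Q p {i, j}) := hφ.mono_set (voronoiCell_subset _ _)
  rw [integral_sub (h1.smul_const _)
    ((integrableOn_smul_self hQ hφ).mono_set (voronoiCell_subset _ _)), integral_smul_const]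
  rfl

variable (hφ0 : ∀ q ∈ Q, 0 ≤ φ q)

include hφ0

lemma centroidW_eq (p : Config n) (i : Fin n) :
    centroidW Q φ p i = (massW Q φ p i)⁻¹ • momentW Q φ p i := by
  rw [centroidW, momentW]
  congr 1
  refine Finset.sum_congr rfl fun T _ => ?_
  exact mass_smul_massCentroid hφ hφ0 (isClosed_voronoiCell hQ.isClosed p T).measurableSet
    (voronoiCell_subset p T)

lemma massW_le (p : Config n) (i : Fin n) :
    massW Q φ p i ≤ Fintype.card (Finset (Fin n)) * mass φ Q := by
  have h0 : 0 ≤ mass φ Q := mass_nonneg hφ0 hQ.measurableSet subset_rfl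
  refine (Finset.sum_le_card_nsmul _ _ (mass φ Q) fun T _ =>
    mass_mono hφ hφ0 hQ.measurableSet (voronoiCell_subset p T) subset_rfl).trans ?_
  rw [nsmul_eq_mul]
  refine mul_le_mul_of_nonneg_right ?_ h0
  exact_mod_cast Finset.card_le_univ _

/-- Each point of `Q` in the ball has `i` as a nearest agent, hence lies in the cell of some pair
containing `i`. If those cells had no mass, `φ` would vanish almost everywhere on `Q ∩ ball`. -/
lemma massW_pos (hn : 2 ≤ n) (hdisc : ∀ q ∈ Q, ∀ r : ℝ, 0 < r → 0 < mass φ (Q ∩ Metric.ball q r))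
    {p : Config n} {i : Fin n} {y : Plane} (hy : y ∈ Q) {r : ℝ} (hr : 0 < r)
    (h : ∀ q ∈ Metric.ball y r, ∀ j, dist q (p i) ≤ dist q (p j)) : 0 < massW Q φ p i := by
  have hm := fun T => (isClosed_voronoiCell hQ.isClosed p T).measurableSet
  by_contra hcon
  have h0 : massW Q φ p i = 0 := le_antisymm (not_lt.1 hcon) (massW_nonneg hQ hφ0 p i)
  have h1 := (Finset.sum_eq_zero_iff_of_nonneg fun T _ => mass_nonneg hφ0 (hm T)
    (voronoiCell_subset p T)).1 h0
  have h2 : ∀ᵐ q : Plane, ∀ T ∈ pairsWith i, q ∈ voronoiCell Q p T → φ q = 0 := by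
    rw [Filter.eventually_all_finset]
    intro T hT
    rw [← ae_restrict_iff' (hm T)]
    refine (setIntegral_eq_zero_iff_of_nonneg_ae ?_
      (hφ.mono_set (voronoiCell_subset p T))).1 (h1 T hT)
    filter_upwards [ae_restrict_mem (hm T)] with q hq using hφ0 q hq.1
  refine (hdisc y hy r hr).ne' ?_
  apply integral_eq_zero_of_ae
  filter_upwards [ae_restrict_of_ae h2,
    ae_restrict_mem (hQ.measurableSet.inter Metric.isOpen_ball.measurableSet)] with q hq hqm
  obtain ⟨j, hj⟩ := IsNearestPair.exists_of_forall_le hn (d := fun l => dist q (p l)) (i := i)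
    (h q hqm.2)
  refine hq {i, j} ?_ ((mem_voronoiCell_pair hj.1).2 ⟨hqm.1, hj⟩)
  simp only [pairsWith, Finset.mem_filter, Finset.mem_powersetCard]
  exact ⟨⟨Finset.subset_univ _, Finset.card_pair hj.1⟩, by simp⟩

/-- An average of points of a closed convex set stays in it, by separation. Overlapping cells are
harmless: `massW` and `momentW` count them with the same multiplicity. -/
lemma centroidW_mem (hQconv : Convex ℝ Q) {p : Config n} {i : Fin n}
    (h : 0 < massW Q φ p i) : centroidW Q φ p i ∈ Q := by
  by_contra hcon
  obtain ⟨ℓ, u, hu, hlt⟩ := geometric_hahn_banach_closed_point hQconv hQ.isClosed hcon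
  refine absurd hlt (not_lt.2 ?_)
  rw [centroidW_eq hQ hφ hφ0, map_smul, smul_eq_mul, inv_mul_le_iff₀ h, momentW, massW, map_sum,
    Finset.sum_mul]
  refine Finset.sum_le_sum fun T _ => ?_
  have hs := voronoiCell_subset (Q := Q) p T
  have h1 : IntegrableOn (fun q => φ q • q) (voronoiCell Q p T) :=
    (integrableOn_smul_self hQ hφ).mono_set hs
  rw [← ContinuousLinearMap.integral_comp_comm _ h1, mass, ← integral_mul_const]
  refine setIntegral_mono_on (ℓ.integrable_comp h1) ((hφ.mono_set hs).mul_const u)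
    (isClosed_voronoiCell hQ.isClosed p T).measurableSet fun q hq => ?_
  rw [map_smul, smul_eq_mul]
  exact mul_le_mul_of_nonneg_left (hu q (hs hq)).le (hφ0 q (hs hq))

end Mass

/-! ### Cells at collision configurations -/

lemma exists_pos_le_dist {n : ℕ} (x : Config n) :
    ∃ δ : ℝ, 0 < δ ∧ ∀ i j, x i ≠ x j → δ ≤ dist (x i) (x j) := by
  have h : ∀ i j, ∀ᶠ δ in 𝓝[>] (0 : ℝ), x i ≠ x j → δ ≤ dist (x i) (x j) := by
    intro i j
    by_cases hij : x i = x j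
    · exact Eventually.of_forall fun δ h => absurd hij h
    · filter_upwards [eventually_nhdsWithin_of_eventually_nhds
        (eventually_lt_nhds (dist_pos.2 hij))] with δ hδ _ using hδ.le
  obtain ⟨δ, h1, h2⟩ := ((eventually_all.2 fun i => eventually_all.2 (h i)).and
    self_mem_nhdsWithin).exists
  exact ⟨δ, h2, h1⟩

lemma convex_setOf_dist_le (y z : Plane) : Convex ℝ {q : Plane | dist q y ≤ dist q z} := by
  have e : {q : Plane | dist q y ≤ dist q z} =
      {q : Plane | inner ℝ (y - z) (y + z) / 2 ≤ innerSL ℝ (y - z) q} := by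
    ext q
    have h := dist_sq_sub_dist_sq q y z
    rw [inner_sub_right, real_inner_smul_right] at h
    simp only [Set.mem_ofPred_eq, innerSL_apply_apply]
    constructor
    · intro h1
      have : dist q y ^ 2 ≤ dist q z ^ 2 := by gcongr
      linarith
    · intro h1
      exact le_of_sq_le_sq (by linarith) dist_nonneg
  rw [e]
  exact convex_halfSpace_ge (innerSL ℝ (y - z)).toLinearMap.isLinear _

lemma convex_voronoiCell {n : ℕ} {Q : Set Plane} (hQ : Convex ℝ Q) (p : Config n)
    (T : Finset (Fin n)) : Convex ℝ (voronoiCell Q p T) := by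
  have e : voronoiCell Q p T = Q ∩ ⋂ v ∈ T, ⋂ w ∈ {w | w ∉ T},
      {q | dist q (p v) ≤ dist q (p w)} := by
    ext q
    simp [voronoiCell]
  rw [e]
  exact hQ.inter (convex_iInter₂ fun v _ => convex_iInter₂ fun w _ => convex_setOf_dist_le _ _)

/-- The cell of a pair is null if one agent of the pair can be exchanged with an agent at the same
position. -/
def HasNullExchangeableCells {n : ℕ} (Q : Set Plane) (x : Config n) : Prop :=
  ∀ T : Finset (Fin n), T.card = 2 → ∀ i ∈ T, ∀ j ∉ T, x i = x j → volume (voronoiCell Q x T) = 0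

/-- Here `pd` is the distance to the agent, nonzero at generic points, so `φ` vanishes almost
everywhere on the cell. The disc condition then excludes interior points, and a convex set without
interior lies in its null frontier. -/
lemma hasNullExchangeableCells {n : ℕ} {Q : Set Plane} (hQ : IsCompact Q) (hQc : Convex ℝ Q)
    {φ : Plane → ℝ}
    (hdisc : ∀ q ∈ Q, ∀ r : ℝ, 0 < r → 0 < mass φ (Q ∩ Metric.ball q r)) {x : Config n}
    (hnull : ∀ᵐ q ∂(volume.restrict Q), IsExchangeNull quadCost (φ q) q x) :
    HasNullExchangeableCells Q x := by
  intro T hT i hi k hk hik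
  obtain ⟨j, hij, rfl⟩ : ∃ j, i ≠ j ∧ T = {i, j} := by
    obtain ⟨a, b, hab, rfl⟩ := Finset.card_eq_two.1 hT
    simp only [Finset.mem_insert, Finset.mem_singleton] at hi
    rcases hi with rfl | rfl
    · exact ⟨b, hab, rfl⟩
    · exact ⟨a, hab.symm, Finset.pair_comm _ _⟩
  simp only [Finset.mem_insert, Finset.mem_singleton, not_or] at hk
  have h0 : ∀ᵐ q : Plane, q ∈ voronoiCell Q x {i, j} → φ q = 0 := by
    rw [ae_restrict_iff' hQ.measurableSet] at hnull
    filter_upwards [hnull, ae_isGenericFor x] with q hq hg hmem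
    have h1 := hq hmem.1 i j k ((mem_voronoiCell_pair hij).1 hmem).2 hk.1 hk.2 hik.symm
    rw [pd_quadCost] at h1
    exact (mul_eq_zero.1 h1).resolve_right (dist_ne_zero.2 (hg.1 i))
  have hint : interior (voronoiCell Q x {i, j}) = ∅ := by
    by_contra hne
    obtain ⟨y, hy⟩ := nonempty_iff_ne_empty.2 hne
    obtain ⟨r, hr, hball⟩ := Metric.isOpen_iff.1 isOpen_interior y hy
    have hball' := hball.trans interior_subset
    refine (hdisc y (voronoiCell_subset _ _ (interior_subset hy)) r hr).ne' ?_
    apply integral_eq_zero_of_ae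
    filter_upwards [ae_restrict_of_ae h0,
      ae_restrict_mem (hQ.measurableSet.inter Metric.isOpen_ball.measurableSet)] with q hq hqm
    exact hq (hball' hqm.2)
  refine measure_mono_null ?_ ((convex_voronoiCell hQc x {i, j}).addHaar_frontier volume)
  rw [frontier, hint, sdiff_empty]
  exact subset_closure

/-- Take `i ∈ T \ T'` and `j ∈ T' \ T`. If they coincide, the cell of `T` is null; otherwise the
intersection lies on their bisector. -/
lemma volume_voronoiCell_inter {n : ℕ} {Q : Set Plane} {x : Config n}
    (hx : HasNullExchangeableCells Q x) {T T' : Finset (Fin n)} (hT : T.card = 2)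
    (hT' : T'.card = 2) (hne : T ≠ T') :
    volume (voronoiCell Q x T ∩ voronoiCell Q x T') = 0 := by
  obtain ⟨i, hi, hi'⟩ : ∃ i ∈ T, i ∉ T' := by
    by_contra h
    push Not at h
    exact hne (Finset.eq_of_subset_of_card_le h (by omega))
  obtain ⟨j, hj, hj'⟩ : ∃ j ∈ T', j ∉ T := by
    by_contra h
    push Not at h
    exact hne (Finset.eq_of_subset_of_card_le h (by omega)).symm
  by_cases hij : x i = x j
  · exact measure_mono_null inter_subset_left (hx T hT i hi j hj' hij)
  · refine measure_mono_null ?_ (volume_setOf_dist_eq hij)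
    rintro q ⟨h1, h2⟩
    exact le_antisymm (h1.2 i hi j hj') (h2.2 j hj i hi')

/-- The indicators converge almost everywhere. In the cell of `x` a generic point satisfies the
inequalities strictly, cells with coincidences being null, and outside it some inequality is
strictly violated; both persist for large `k`. -/
lemma tendsto_setIntegral_voronoiCell {n : ℕ} {Q : Set Plane} (hQ : IsCompact Q)
    {E : Type*} [NormedAddCommGroup E] [NormedSpace ℝ E] {h : Plane → E} (hh : IntegrableOn h Q)
    {x : Config n} (hx : HasNullExchangeableCells Q x) {p : ℕ → Config n}
    (hp : Tendsto p atTop (𝓝 x)) {T : Finset (Fin n)} (hT : T.card = 2) :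
    Tendsto (fun k => ∫ q in voronoiCell Q (p k) T, h q) atTop
      (𝓝 (∫ q in voronoiCell Q x T, h q)) := by
  have hm := fun y : Config n => (isClosed_voronoiCell hQ.isClosed y T).measurableSet
  have e : ∀ y : Config n, ∫ q in voronoiCell Q y T, h q =
      ∫ q in Q, (voronoiCell Q y T).indicator h q := fun y => by
    rw [setIntegral_indicator (hm y), inter_eq_self_of_subset_right (voronoiCell_subset _ _)]
  simp_rw [e]
  refine tendsto_integral_of_dominated_convergence (fun q => ‖h q‖)
    (fun k => hh.aestronglyMeasurable.indicator (hm _)) hh.norm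
    (fun k => Eventually.of_forall fun q => norm_indicator_le_norm_self _ _) ?_
  have hsep : ∀ᵐ q : Plane, q ∈ voronoiCell Q x T → ∀ v ∈ T, ∀ w ∉ T, x v ≠ x w := by
    by_cases hs : ∃ v ∈ T, ∃ w, w ∉ T ∧ x v = x w
    · obtain ⟨v, hv, w, hw, hvw⟩ := hs
      filter_upwards [measure_eq_zero_iff_ae_notMem.1 (hx T hT v hv w hw hvw)] with q hq hq'
      exact absurd hq' hq
    · push Not at hs
      exact Eventually.of_forall fun q _ => hs
  have hlt : ∀ (q : Plane) (v w : Fin n), dist q (x v) < dist q (x w) →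
      ∀ᶠ k in atTop, dist q (p k v) < dist q (p k w) := fun q v w hvw =>
    (tendsto_const_nhds.dist (tendsto_pi_nhds.1 hp v)).eventually_lt
      (tendsto_const_nhds.dist (tendsto_pi_nhds.1 hp w)) hvw
  filter_upwards [ae_restrict_mem hQ.measurableSet, ae_restrict_of_ae hsep,
    ae_restrict_of_ae (ae_isGenericFor x)] with q hq hqs hg
  apply tendsto_const_nhds.congr'
  by_cases hmem : q ∈ voronoiCell Q x T
  · have h1 : ∀ v w, ∀ᶠ k in atTop, v ∈ T → w ∉ T → dist q (p k v) < dist q (p k w) := by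
      intro v w
      by_cases hvw : v ∈ T ∧ w ∉ T
      · have h2 : dist q (x v) < dist q (x w) := lt_of_le_of_ne (hmem.2 v hvw.1 w hvw.2)
          (hg.2 v w (hqs hmem v hvw.1 w hvw.2))
        filter_upwards [hlt q v w h2] with k hk _ _ using hk
      · exact Eventually.of_forall fun k hv hw => absurd ⟨hv, hw⟩ hvw
    filter_upwards [eventually_all.2 fun v => eventually_all.2 (h1 v)] with k hk
    have h3 : q ∈ voronoiCell Q (p k) T := ⟨hq, fun v hv w hw => (hk v w hv hw).le⟩
    rw [Set.indicator_of_mem hmem, Set.indicator_of_mem h3]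
  · obtain ⟨v, hv, w, hw, hvw⟩ : ∃ v ∈ T, ∃ w, w ∉ T ∧ dist q (x w) < dist q (x v) := by
      by_contra hcon
      push Not at hcon
      exact hmem ⟨hq, hcon⟩
    filter_upwards [hlt q w v hvw] with k hk
    have h3 : q ∉ voronoiCell Q (p k) T := fun h => absurd (h.2 v hv w hw) (not_le.2 hk)
    rw [Set.indicator_of_notMem hmem, Set.indicator_of_notMem h3]

lemma card_of_mem_pairsWith {n : ℕ} {i : Fin n} {T : Finset (Fin n)} (h : T ∈ pairsWith i) :
    T.card = 2 := by
  simp only [pairsWith, Finset.mem_filter, Finset.mem_powersetCard] at h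
  exact h.1.2

/-- Collisions are allowed: coincident agents tie, and `massW_pos` only needs a weak inequality. -/
lemma massW_pos_of_forall_mem {n : ℕ} (hn : 2 ≤ n) {Q : Set Plane} (hQ : IsCompact Q)
    {φ : Plane → ℝ} (hφ : IntegrableOn φ Q) (hφ0 : ∀ q ∈ Q, 0 ≤ φ q)
    (hdisc : ∀ q ∈ Q, ∀ r : ℝ, 0 < r → 0 < mass φ (Q ∩ Metric.ball q r)) {x : Config n}
    (hx : ∀ i, x i ∈ Q) (i : Fin n) : 0 < massW Q φ x i := by
  obtain ⟨δ, hδ, hd⟩ := exists_pos_le_dist x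
  refine massW_pos hQ hφ hφ0 hn hdisc (hx i) (half_pos hδ) fun q hq j => ?_
  by_cases hij : x i = x j
  · rw [hij]
  · have h1 := hd i j hij
    have h2 := dist_triangle_left (x i) (x j) q
    rw [Metric.mem_ball] at hq
    linarith

/-- The nearby `y` may leave `Q`, as the invariance argument requires; in exchange the positions `x
i` must be distinct. -/
lemma eventually_massW_pos {n : ℕ} (hn : 2 ≤ n) {Q : Set Plane} (hQ : IsCompact Q)
    {φ : Plane → ℝ} (hφ : IntegrableOn φ Q) (hφ0 : ∀ q ∈ Q, 0 ≤ φ q)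
    (hdisc : ∀ q ∈ Q, ∀ r : ℝ, 0 < r → 0 < mass φ (Q ∩ Metric.ball q r)) {x : Config n}
    (hinj : Function.Injective x) (hx : ∀ i, x i ∈ Q) :
    ∀ᶠ y in 𝓝 x, ∀ i, 0 < massW Q φ y i := by
  obtain ⟨δ, hδ, hd⟩ := exists_pos_le_dist x
  filter_upwards [Metric.ball_mem_nhds x (show 0 < δ / 4 by linarith)] with y hy i
  refine massW_pos hQ hφ hφ0 hn hdisc (hx i) (show 0 < δ / 4 by linarith) fun q hq j => ?_
  by_cases hij : i = j
  · rw [hij]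
  · have h1 := hd i j (hinj.ne hij)
    have h3 := dist_triangle q (x i) (y i)
    rw [Metric.mem_ball] at hq hy
    have h4 : ∀ k, dist (y k) (x k) < δ / 4 := fun k => (dist_le_pi_dist y x k).trans_lt hy
    have h5 := h4 i
    have h6 := h4 j
    rw [dist_comm] at h5
    have h7 : dist (x i) (x j) ≤ dist q (x i) + (dist q (y j) + dist (y j) (x j)) :=
      (dist_triangle_left (x i) (x j) q).trans
        (add_le_add_right (dist_triangle q (y j) (x j)) _)
    linarith

/-! ### The centroid flow -/

/-- Centroids are known to lie in `Q` only if the masses are positive, which in turn is derived from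
the agents being in `Q`. Continuous induction breaks the circle: just after a time with all agents
in `Q` the masses are still positive, so a functional bounded by `u` on `Q` cannot rise above `u`
along an agent. -/
lemma forall_mem_of_centroidFlow {n : ℕ} (hn : 2 ≤ n) {Q : Set Plane} (hQ : IsCompact Q)
    (hQc : Convex ℝ Q) {φ : Plane → ℝ} (hφ : IntegrableOn φ Q) (hφ0 : ∀ q ∈ Q, 0 ≤ φ q)
    (hdisc : ∀ q ∈ Q, ∀ r : ℝ, 0 < r → 0 < mass φ (Q ∩ Metric.ball q r)) {K : ℝ} (hK : 0 < K)
    {p : ℝ → Config n} (hp0 : ∀ i, p 0 i ∈ Q)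
    (hp : IsClosedLoopSolution (fun x i => K • (centroidW Q φ x i - x i)) p) {t : ℝ}
    (ht : 0 ≤ t) : ∀ i, p t i ∈ Q := by
  have hc : ContinuousOn p (Ici 0) := fun s hs =>
    (hasDerivWithinAt_pi.2 (hp s hs).2).continuousWithinAt
  let s : Set ℝ := p ⁻¹' {x | ∀ i, x i ∈ Q}
  have hclosed : IsClosed {x : Config n | ∀ i, x i ∈ Q} := by
    have e : {x : Config n | ∀ i, x i ∈ Q} = Set.univ.pi fun _ => Q := by ext; simp
    rw [e]
    exact isClosed_set_pi fun _ _ => hQ.isClosed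
  have hsub : Icc 0 t ⊆ s := by
    refine IsClosed.Icc_subset_of_forall_exists_gt ?_ hp0 ?_
    · rw [inter_comm]
      exact (hc.mono Icc_subset_Ici_self).preimage_isClosed_of_isClosed isClosed_Icc hclosed
    · rintro a ⟨has, ha⟩ b hb
      have hev : ∀ᶠ u in 𝓝[≥] a, ∀ i, 0 < massW Q φ (p u) i :=
        ((hc a ha.1).mono (Ici_subset_Ici.2 ha.1)).eventually
          (eventually_massW_pos hn hQ hφ hφ0 hdisc (hp a ha.1).1 has)
      obtain ⟨c, hac, hcsub⟩ := mem_nhdsGE_iff_exists_Icc_subset.1 hev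
      rw [mem_Ioi] at hb
      let e := min b c
      have hae : a < e := lt_min hb hac
      refine ⟨e, fun i => ?_, hae, min_le_left _ _⟩
      by_contra hcon
      obtain ⟨ℓ, u, hu, hlt⟩ := geometric_hahn_banach_closed_point hQc hQ.isClosed hcon
      refine absurd hlt (not_lt.2 ?_)
      have hd : ∀ r, 0 ≤ r → HasDerivWithinAt (fun r => ℓ (p r i))
          (ℓ (K • (centroidW Q φ (p r) i - p r i))) (Ici 0) r := fun r hr =>
        ℓ.hasFDerivAt.comp_hasDerivWithinAt r ((hp r hr).2 i)
      refine le_of_deriv_right_nonpos_above (y := fun r => ℓ (p r i)) (a := a) (b := e)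
        (fun r hr => ((hd r (ha.1.trans hr.1)).continuousWithinAt).mono
          fun z hz => ha.1.trans hz.1)
        (fun r hr => hasDerivWithinAt_Ici_of_nonneg (ha.1.trans hr.1) (hd r (ha.1.trans hr.1)))
        (hu _ (has i)).le (fun r hr hgt => ?_) (right_mem_Icc.2 hae.le)
      have h1 : 0 < massW Q φ (p r) i :=
        hcsub ⟨hr.1, hr.2.le.trans (min_le_right _ _)⟩ i
      have h2 := hu _ (centroidW_mem hQ hφ hφ0 hQc h1)
      rw [map_smul, map_sub, smul_eq_mul]
      exact mul_nonpos_of_nonneg_of_nonpos hK.le (by linarith)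
  exact hsub (right_mem_Icc.2 ht)

lemma tendsto_massW {n : ℕ} {Q : Set Plane} (hQ : IsCompact Q)
    {φ : Plane → ℝ} (hφ : IntegrableOn φ Q) {x : Config n}
    (hx : HasNullExchangeableCells Q x) {p : ℕ → Config n}
    (hp : Tendsto p atTop (𝓝 x)) (i : Fin n) :
    Tendsto (fun k => massW Q φ (p k) i) atTop (𝓝 (massW Q φ x i)) :=
  tendsto_finsetSum _ fun _ hT =>
    tendsto_setIntegral_voronoiCell hQ hφ hx hp (card_of_mem_pairsWith hT)

lemma tendsto_momentW {n : ℕ} {Q : Set Plane} (hQ : IsCompact Q)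
    {φ : Plane → ℝ} (hφ : IntegrableOn φ Q) {x : Config n}
    (hx : HasNullExchangeableCells Q x) {p : ℕ → Config n}
    (hp : Tendsto p atTop (𝓝 x)) (i : Fin n) :
    Tendsto (fun k => momentW Q φ (p k) i) atTop (𝓝 (momentW Q φ x i)) :=
  tendsto_finsetSum _ fun _ hT =>
    tendsto_setIntegral_voronoiCell hQ (integrableOn_smul_self hQ hφ) hx hp
      (card_of_mem_pairsWith hT)

lemma cellGradient_quadCost_eq {n : ℕ} {Q : Set Plane} (hQ : IsCompact Q)
    {φ : Plane → ℝ} (hφ : IntegrableOn φ Q) (hφ0 : ∀ q ∈ Q, 0 ≤ φ q) {x : Config n} {i : Fin n}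
    (h : 0 < massW Q φ x i) :
    cellGradient Q φ quadCost x i = massW Q φ x i • (x i - centroidW Q φ x i) := by
  rw [cellGradient_quadCost hQ hφ, centroidW_eq hQ hφ hφ0, smul_sub, smul_inv_smul₀ h.ne']

/-- Cluster points of the centroid flow. -/
lemma centroidal_of_mapClusterPt {n : ℕ} (hn : 2 ≤ n) {Q : Set Plane} (hQ : IsCompact Q)
    (hQc : Convex ℝ Q) {φ : Plane → ℝ} (hφ : IntegrableOn φ Q) (hφ0 : ∀ q ∈ Q, 0 ≤ φ q)
    (hdisc : ∀ q ∈ Q, ∀ r : ℝ, 0 < r → 0 < mass φ (Q ∩ Metric.ball q r)) {K : ℝ} (hK : 0 < K)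
    {p : ℝ → Config n} (hp0 : ∀ i, p 0 i ∈ Q)
    (hp : IsClosedLoopSolution (fun x i => K • (centroidW Q φ x i - x i)) p) {x : Config n}
    (hx : MapClusterPt x atTop p) :
    HasNullExchangeableCells Q x ∧ IsCentroidalConfig Q φ x ∧
      x ∈ criticalPoints (performance Q φ quadCost) := by
  have hf := isSensingCost_quadCost
  have hmem : ∀ t, 0 ≤ t → ∀ i, p t i ∈ Q := fun t ht =>
    forall_mem_of_centroidFlow hn hQ hQc hφ hφ0 hdisc hK hp0 hp ht
  have hpos : ∀ t, 0 ≤ t → ∀ i, 0 < massW Q φ (p t) i := fun t ht i =>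
    massW_pos_of_forall_mem hn hQ hφ hφ0 hdisc (hmem t ht) i
  obtain ⟨R, hR⟩ := hQ.isBounded.exists_norm_le
  have hR0 : 0 ≤ R := (norm_nonneg _).trans (hR _ (hp0 ⟨0, by omega⟩))
  -- An upper bound for every `massW`; the `1` makes it positive.
  let M := Fintype.card (Finset (Fin n)) * mass φ Q + 1
  have hM : 0 < M := by
    have := mass_nonneg hφ0 hQ.measurableSet subset_rfl
    positivity
  obtain ⟨s, hs0, hs1, hs2⟩ := exists_seq_cellGradient_tendsto_zero hn hQ hφ hf
    (F := fun t i => K • (centroidW Q φ (p t) i - p t i)) (fun t ht => (hp t ht).1)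
    (fun t ht => hasDerivWithinAt_pi.2 (hp t ht).2) (show 0 < K / M by positivity) (R := R)
    (fun t ht => (pi_norm_le_iff_of_nonneg hR0).2 fun i => hR _ (hmem t ht i))
    (V := K * (R + R))
    (fun t ht => by
      rw [pi_norm_le_iff_of_nonneg (by positivity)]
      intro i
      rw [norm_smul, Real.norm_of_nonneg hK.le]
      refine mul_le_mul_of_nonneg_left ((norm_sub_le _ _).trans ?_) hK.le
      exact add_le_add (hR _ (centroidW_mem hQ hφ hφ0 hQc (hpos t ht i))) (hR _ (hmem t ht i)))
    (fun t ht => by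
      -- With `∇_i H = m (p_i - C_i)` and `w = ‖p_i - C_i‖²`, the flow contributes `-K m w` and the
      -- squared gradient is `m² w ≤ M m w`; hence the rate `K / M`.
      have h1 : pairing n (cellGradient Q φ quadCost (p t))
          (fun i => K • (centroidW Q φ (p t) i - p t i)) ≤ -(K / M) *
          pairing n (cellGradient Q φ quadCost (p t)) (cellGradient Q φ quadCost (p t)) := by
        rw [pairing_apply, pairing_apply, Finset.mul_sum]
        refine Finset.sum_le_sum fun i _ => ?_
        have hm := hpos t ht i
        rw [cellGradient_quadCost_eq hQ hφ hφ0 hm, ← neg_sub (p t i), real_inner_smul_left,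
          real_inner_smul_left, real_inner_smul_right, real_inner_smul_right, inner_neg_right]
        set m := massW Q φ (p t) i
        set w : ℝ := inner ℝ (p t i - centroidW Q φ (p t) i) (p t i - centroidW Q φ (p t) i)
        have hw : 0 ≤ w := real_inner_self_nonneg
        have hmM : m ≤ M := by
          have := massW_le hQ hφ hφ0 (p t) i
          simp only [M]
          linarith
        have h2 : K / M * m ≤ K := by
          rw [div_mul_eq_mul_div, div_le_iff₀ hM]
          exact mul_le_mul_of_nonneg_left hmM hK.le
        have h3 : K / M * m * (m * w) ≤ K * (m * w) :=
          mul_le_mul_of_nonneg_right h2 (by positivity)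
        linarith
      have h4 := mul_le_mul_of_nonneg_left
        (sq_norm_le_pairing_self (cellGradient Q φ quadCost (p t))) (show 0 ≤ K / M by positivity)
      linarith) hx
  have hinj := fun k => (hp _ (hs0 k)).1
  have hnull := hasNullExchangeableCells hQ hQc hdisc
    (ae_isExchangeNull_of_tendsto hn hQ hφ hφ0 hf hs1 hinj hs2)
  have hxQ : ∀ i, x i ∈ Q := fun i => hQ.isClosed.mem_of_tendsto (tendsto_pi_nhds.1 hs1 i)
    (Eventually.of_forall fun k => hmem _ (hs0 k) i)
  have hxpos : ∀ i, 0 < massW Q φ x i := fun i =>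
    massW_pos_of_forall_mem hn hQ hφ hφ0 hdisc hxQ i
  refine ⟨hnull, ⟨hxQ, fun T T' hT hT' hne => volume_voronoiCell_inter hnull hT hT' hne,
    fun i => ⟨hxpos i, ?_⟩⟩, mem_criticalPoints_of_tendsto hn hQ hφ hφ0 hf hs1 hinj hs2⟩
  -- Masses and moments are continuous at `x`, so `M p_i - momentW → 0` passes to the limit.
  have h1 := tendsto_pi_nhds.1 hs2 i
  simp_rw [cellGradient_quadCost hQ hφ] at h1
  have h2 := ((tendsto_massW hQ hφ hnull hs1 i).smul (tendsto_pi_nhds.1 hs1 i)).sub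
    (tendsto_momentW hQ hφ hnull hs1 i)
  have h3 := sub_eq_zero.1 (tendsto_nhds_unique h2 h1)
  rw [centroidW_eq hQ hφ hφ0, ← h3, inv_smul_smul₀ (hxpos i).ne']

lemma centroidFlow_convergence {n : ℕ} (hn : 2 ≤ n) {Q : Set Plane} (hQ : IsCompact Q)
    (hQc : Convex ℝ Q) {φ : Plane → ℝ} (hφ : IntegrableOn φ Q) (hφ0 : ∀ q ∈ Q, 0 ≤ φ q)
    (hdisc : ∀ q ∈ Q, ∀ r : ℝ, 0 < r → 0 < mass φ (Q ∩ Metric.ball q r)) {K : ℝ} (hK : 0 < K)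
    {p : ℝ → Config n} (hp0 : ∀ i, p 0 i ∈ Q)
    (hp : IsClosedLoopSolution (fun x i => K • (centroidW Q φ x i - x i)) p) :
    (∀ i, Tendsto (fun t => p t i - centroidW Q φ (p t) i) atTop (𝓝 0)) ∧
      ConvergesToSet p
        {x | IsCentroidalConfig Q φ x ∧ x ∈ criticalPoints (performance Q φ quadCost)} := by
  have hB : IsCompact (Set.univ.pi fun _ : Fin n => Q) := isCompact_univ_pi fun _ => hQ
  have hmem : ∀ t, 0 ≤ t → p t ∈ Set.univ.pi fun _ : Fin n => Q := fun t ht i _ =>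
    forall_mem_of_centroidFlow hn hQ hQc hφ hφ0 hdisc hK hp0 hp ht i
  refine ⟨fun i => ?_, convergesToSet_of_mapClusterPt hB hmem fun x hx =>
    (centroidal_of_mapClusterPt hn hQ hQc hφ hφ0 hdisc hK hp0 hp hx).2⟩
  -- Any sequence of times tending to infinity has a subsequence along which `p` converges to a
  -- cluster point; there the centroids are continuous and equal the positions.
  refine tendsto_of_subseq_tendsto fun ns hns => ?_
  obtain ⟨x, -, ms, hms, hlim⟩ := hB.tendsto_subseq' (x := fun k => p (ns k))
    ((hns.eventually (eventually_ge_atTop 0)).mono fun k hk => hmem _ hk).frequently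
  have hx : MapClusterPt x atTop p :=
    MapClusterPt.of_comp (φ := fun k => ns (ms k)) (hns.comp hms.tendsto_atTop)
      (Tendsto.mapClusterPt hlim)
  obtain ⟨hnull, hcent, -⟩ := centroidal_of_mapClusterPt hn hQ hQc hφ hφ0 hdisc hK hp0 hp hx
  refine ⟨ms, ?_⟩
  have h1 := ((tendsto_massW hQ hφ hnull hlim i).inv₀ (hcent.2.2 i).1.ne').smul
    (tendsto_momentW hQ hφ hnull hlim i)
  rw [← centroidW_eq hQ hφ hφ0, ← (hcent.2.2 i).2] at h1
  have h2 := (tendsto_pi_nhds.1 hlim i).sub h1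
  rw [sub_self] at h2
  refine h2.congr fun k => ?_
  rw [centroidW_eq hQ hφ hφ0]
  rfl

theorem lemma3 (n : ℕ) (hn : 2 ≤ n) (Q : Set Plane) (hQc : IsCompact Q) (hQ : Convex ℝ Q)
    (φ : Plane → ℝ) (hφ : IntegrableOn φ Q) (hφ0 : ∀ q ∈ Q, 0 ≤ φ q) :
    (∀ f : ℝ → ℝ → ℝ, IsSensingCost f →
      (∀ x : Config n, Function.Injective x →
        DifferentiableAt ℝ (performance Q φ f : Config n → ℝ) x ∧
        ∀ i, HasGradientAt (fun y : Plane => performance Q φ f (Function.update x i y))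
          (cellGradient Q φ f x i) (x i)) ∧
      (∀ p : ℝ → Config n,
        IsClosedLoopSolution (fun x i => -cellGradient Q φ f x i) p →
        ConvergesToSet p (criticalPoints (performance Q φ f)))) ∧
    ((∀ q ∈ Q, ∀ r : ℝ, 0 < r → 0 < mass φ (Q ∩ Metric.ball q r)) →
      ∀ K : ℝ, 0 < K → ∀ p : ℝ → Config n, (∀ i, p 0 i ∈ Q) →
        IsClosedLoopSolution (fun x i => K • (centroidW Q φ x i - x i)) p →
        (∀ i, Tendsto (fun t => p t i - centroidW Q φ (p t) i) atTop (𝓝 0)) ∧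
        ConvergesToSet p
          {x | IsCentroidalConfig Q φ x ∧ x ∈ criticalPoints (performance Q φ quadCost)}) := by
  refine ⟨fun f hf => ⟨fun x hx => ⟨(hasFDerivAt_performance hn hQc hφ hf hx).differentiableAt,
    fun i => hasGradientAt_performance_update hn hQc hφ hf hx i⟩,
    fun p hp => gradientFlow_convergesToSet hn hQc hφ hφ0 hf hp⟩, fun hdisc K hK p hp0 hp =>
    centroidFlow_convergence hn hQc hQ hφ hφ0 hdisc hK hp0 hp⟩
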